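/- Let $E_n$ be the edge set of the complete graph $K_n$ on the node set $\{1,\dots,n\}$, and let $P^{\ell}_{\mathrm{match}}(n)\subseteq\mathbb{R}^{E_n}$ be the convex hull of the characteristic vectors of all matchings $M\subseteq E_n$ with $|M|=\ell$. The symmetric group $S_n$ acts on $\mathbb{R}^{E_n}$ by permuting the nodes: $(\pi.x)_{\{v,w\}}=x_{\{\pi^{-1}(v),\pi^{-1}(w)\}}$. An extension of a polytope $P\subseteq\mathbb{R}^m$ is a polyhedron $Q\subseteq\mathbb{R}^d$ (for some $d$) together with an affine map $p:\mathbb{R}^d\to\mathbb{R}^m$ such that $p(Q)=P$; its size is the number of facets of $Q$, a facet being a nonempty face of dimension $\dim Q-1$. An extension $(Q,p)$ of $P^{\ell}_{\mathrm{match}}(n)$ is called symmetric if for every $\pi\in S_n$ there is an affine isometry $\varkappa_\pi$ of $\mathbb{R}^d$ (with respect to the Euclidean norm) with $\varkappa_\pi(Q)=Q$ and $p(\varkappa_\pi(y))=\pi.p(y)$ for all $y\in Q$. **Theorem.** There is a constant $C>0$ such that, for all integers $n\ge 3$ and $\ell$ with $1\le\ell\le\frac n2$, every symmetric extension of $P^{\ell}_{\mathrm{match}}(n)$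 has size at least $$C\cdot\binom{n}{\lfloor(\ell-1)/2\rfloor}.$$ -/

import Mathlib

namespace SymExt

/-- The space `ℝ^d` with its Euclidean structure. -/
abbrev RSpace (d : ℕ) : Type := EuclideanSpace ℝ (Fin d)

/-- A polyhedron in `ℝ^d`: the solution set of a finite system of linear inequalities. -/
def IsPolyhedron {d : ℕ} (Q : Set (RSpace d)) : Prop :=
  ∃ (k : ℕ) (a : Fin k → RSpace d) (b : Fin k → ℝ), Q = {y | ∀ i, inner ℝ (a i) y ≤ b i}

/-- A facet of `Q`: a nonempty face `F` of `Q` (the set of maximizers over `Q` of some linear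
functional) with `dim F = dim Q - 1`, dimensions being those of the affine hulls. -/
def IsFacet {d : ℕ} (Q F : Set (RSpace d)) : Prop :=
  F.Nonempty ∧ IsExposed ℝ Q F ∧
    Module.finrank ℝ (affineSpan ℝ F).direction + 1 = Module.finrank ℝ (affineSpan ℝ Q).direction

/-- The size of `Q`: its number of facets. -/
noncomputable def size {d : ℕ} (Q : Set (RSpace d)) : ℕ :=
  Set.ncard {F : Set (RSpace d) | IsFacet Q F}

section Extension

variable {V : Type*} [AddCommGroup V] [Module ℝ V] {d : ℕ}

/-- The polyhedron `Q ⊆ ℝ^d` together with the affine map `p` is an extension of `P`. -/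
structure IsExtension (P : Set V) (Q : Set (RSpace d)) (p : RSpace d →ᵃ[ℝ] V) : Prop where
  isPolyhedron : IsPolyhedron Q
  image_eq : p '' Q = P

/-- The extension `Q`, `p` of `P` is (isometry-)symmetric with respect to a group `G` of affine
transformations of the ambient space of `P`: each `π ∈ G` is induced by an affine isometry of
`ℝ^d` that maps `Q` onto itself. -/
structure IsSymmetricExtension (G : Subgroup (V ≃ᵃ[ℝ] V)) (P : Set V) (Q : Set (RSpace d))
    (p : RSpace d →ᵃ[ℝ] V) : Prop extends IsExtension P Q p where
  symmetric : ∀ π ∈ G, ∃ κ : RSpace d ≃ᵃⁱ[ℝ] RSpace d,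
    κ '' Q = Q ∧ ∀ y ∈ Q, p (κ y) = π (p y)

end Extension

/-- The edge set `E_n` of the complete graph `K_n` on `n` nodes. -/
abbrev KEdge (n : ℕ) : Type := (SimpleGraph.completeGraph (Fin n)).edgeSet

/-- `M ⊆ E_n` is a matching: no two distinct edges of `M` share a node. -/
def IsMatching {n : ℕ} (M : Finset (KEdge n)) : Prop :=
  ∀ e ∈ M, ∀ f ∈ M, e ≠ f → ∀ v : Fin n, ¬ (v ∈ (e : Sym2 (Fin n)) ∧ v ∈ (f : Sym2 (Fin n)))

/-- The characteristic vector `χ(M) ∈ {0,1}^{E_n}` of a set `M` of edges. -/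
noncomputable def charVec {n : ℕ} (M : Finset (KEdge n)) : KEdge n → ℝ :=
  Set.indicator (M : Set (KEdge n)) 1

/-- The polytope `P_match^ℓ(n)`: the convex hull of the characteristic vectors of all matchings
of cardinality `ℓ` in `K_n`. -/
def matchingPolytope (n ℓ : ℕ) : Set (KEdge n → ℝ) :=
  convexHull ℝ {x | ∃ M : Finset (KEdge n), IsMatching M ∧ M.card = ℓ ∧ x = charVec M}

/-- The permutation `{v, w} ↦ {π v, π w}` of the edges of `K_n` induced by a permutation `π` of
the nodes. -/
def edgePerm {n : ℕ} (π : Equiv.Perm (Fin n)) : Equiv.Perm (KEdge n) :=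
  (SimpleGraph.Iso.completeGraph π).mapEdgeSet

/-- The action of the symmetric group `S_n` on `ℝ^{E_n}` by permuting the nodes of `K_n`:
`(π.x)_{v,w} = x_{π⁻¹ v, π⁻¹ w}`. -/
def nodeAction (n : ℕ) : Equiv.Perm (Fin n) →* ((KEdge n → ℝ) ≃ᵃ[ℝ] (KEdge n → ℝ)) where
  toFun π := (LinearEquiv.funCongrLeft ℝ ℝ (edgePerm π⁻¹)).toAffineEquiv
  map_one' := by
    ext x ⟨e, he⟩
    induction e with
    | _ v w => rfl
  map_mul' π τ := by
    ext x ⟨e, he⟩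
    induction e with
    | _ v w => rfl

/-- The group `S_n`, as a group of affine transformations of `ℝ^{E_n}`. -/
def nodeGroup (n : ℕ) : Subgroup ((KEdge n → ℝ) ≃ᵃ[ℝ] (KEdge n → ℝ)) :=
  (nodeAction n).range

end SymExt

namespace SymExt

open Equiv Equiv.Perm

/-! Put k = ⌊(ℓ-1)/2⌋ and suppose that a symmetric extension has fewer than C(n,k) facets, where n
is large and k ≥ 1. The distance of a point of Q to the affine hull of a facet is an affine slack
function, and isometric symmetries permute these functions. Averaging an arbitrary section over the
finite group of induced pairs (node permutation, facet permutation) gives a section along which each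
slack is invariant under a subgroup of S_n of index at most the number of facets
(`IsSymmetricExtension.exists_section`). A subgroup of index below C(n,k) contains every even
permutation that fixes a certain set W of at most k nodes pointwise
(`exists_small_set_of_index_lt`). Consequently the slack at a matching of size ℓ depends only on the
matching edges that touch W (`apply_eq_of_touching_eq`).

To contradict this, choose a node set A of odd size 2k+1 inside a set S of size 4k+2, and complete
the perfect matchings on S by a fixed matching E₀ outside S to size ℓ. Among perfect matchings on S
with i edges leaving A, the fraction containing a given small matching τ is a polynomial in i of
degree at most |τ|. Only odd i occur, but extrapolating from i = 1, 3, …, 2k+1 to i = 0 yields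
signed weights of sum 1 that are nonnegative on every event "contains τ" with |τ| ≤ k, although the
weighted number of edges leaving A is 0 (`exists_signed_weights`).

The corresponding affine combination of section points has nonnegative slacks
(`sum_weights_mul_nonneg`), so it lies in Q and its image lies in the matching polytope. That image
violates the odd cut inequality for A, which is impossible (`choose_le_size`). For bounded n, and
for k = 0, it suffices that there is at least one facet (`one_le_size`). -/

theorem conj_mem {G : Type*} [Group G] {U : Subgroup G} {g h : G} (hg : g ∈ U) (hh : h ∈ U) :
    g * h * g⁻¹ ∈ U :=
  U.mul_mem (U.mul_mem hg hh) (U.inv_mem hg)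

/-! ### Three-cycles contained in a permutation group. -/

section ThreeCycles

variable {α : Type*} [DecidableEq α]

/-- The three-cycle `a ↦ b ↦ c ↦ a` (for distinct `a`, `b`, `c`). -/
def cyc (a b c : α) : Perm α := swap a b * swap b c

theorem conj_cyc (g : Perm α) (a b c : α) : g * cyc a b c * g⁻¹ = cyc (g a) (g b) (g c) := by
  ext x
  simp only [cyc, Perm.mul_apply]
  have h : ∀ x y z : α, g (swap x y z) = swap (g x) (g y) (g z) := fun x y z => by
    rw [swap_apply_def, swap_apply_def]
    simp only [EmbeddingLike.apply_eq_iff_eq]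
    split_ifs <;> rfl
  rw [h, h, ← Perm.mul_apply g, mul_inv_cancel, Perm.one_apply]

theorem cyc_rotate {a b c : α} (hab : a ≠ b) (hbc : b ≠ c) (hac : a ≠ c) :
    cyc a b c = cyc b c a := by
  ext x
  simp only [cyc, Perm.mul_apply, swap_apply_def]
  grind

theorem cyc_inv (a b c : α) : (cyc a b c)⁻¹ = cyc c b a := by
  simp [cyc, swap_comm]

theorem cyc_apply {a b c : α} (hab : a ≠ b) (hbc : b ≠ c) (hac : a ≠ c) :
    cyc a b c a = b ∧ cyc a b c b = c ∧ cyc a b c c = a := by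
  simp only [cyc, Perm.mul_apply, swap_apply_def]
  grind

theorem cyc_apply_of_ne {a b c x : α} (ha : x ≠ a) (hb : x ≠ b) (hc : x ≠ c) :
    cyc a b c x = x := by
  simp only [cyc, Perm.mul_apply, swap_apply_def]
  grind

/-- Two points are linked by `U` if they are equal or some three-cycle in `U` moves both. -/
def Linked (U : Subgroup (Perm α)) (a b : α) : Prop :=
  a = b ∨ ∃ c, a ≠ b ∧ b ≠ c ∧ a ≠ c ∧ cyc a b c ∈ U

variable {U : Subgroup (Perm α)}

/-- Let (a b x) and (b c y) be the given cycles. In the generic case, conjugating (a b x) by (b c y)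
gives (a c x), and conjugating this by (a b x) gives (b c a). For x = y, one conjugation of (b c x)
by (x b a) gives (a c b), the inverse of the desired cycle. -/
theorem cyc_mem_of_linked {a b c : α} (hab : a ≠ b) (hbc : b ≠ c) (hac : a ≠ c)
    (h₁ : Linked U a b) (h₂ : Linked U b c) : cyc a b c ∈ U := by
  obtain rfl | ⟨x, -, hbx, hax, hx⟩ := h₁
  · exact absurd rfl hab
  obtain rfl | ⟨y, -, hcy, hby, hy⟩ := h₂
  · exact absurd rfl hbc
  have hx' : cyc x b a ∈ U := by rw [← cyc_inv]; exact U.inv_mem hx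
  have hfin : cyc a c b ∈ U → cyc a b c ∈ U := fun h => by
    rw [cyc_rotate hab hbc hac, cyc_rotate hbc hac.symm hab.symm, ← cyc_inv b a c, inv_mem_iff,
      cyc_rotate hab.symm hac hbc]
    exact h
  by_cases hxc : x = c
  · rwa [hxc] at hx
  by_cases hya : y = a
  · subst hya
    rwa [cyc_rotate hab hbc hac]
  by_cases hxy : x = y
  · subst hxy
    have h := conj_mem hx' hy
    rw [conj_cyc] at h
    obtain ⟨e1, e2, e3⟩ := cyc_apply hbx.symm hab.symm hax.symm
    rw [e1, e2, cyc_apply_of_ne (Ne.symm hxc) hbc.symm hac.symm] at h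
    exact hfin h
  · have h := conj_mem hy hx
    rw [conj_cyc] at h
    obtain ⟨e1, e2, e3⟩ := cyc_apply hbc hcy hby
    rw [e1, cyc_apply_of_ne hab hac (Ne.symm hya), cyc_apply_of_ne hbx.symm hxc hxy] at h
    have h' := conj_mem hx h
    rw [conj_cyc] at h'
    obtain ⟨e1, e2, e3⟩ := cyc_apply hab hbx hax
    rw [e1, e3, cyc_apply_of_ne hac.symm hbc.symm (Ne.symm hxc)] at h'
    rwa [cyc_rotate hab hbc hac]

theorem Linked.symm {a b : α} (h : Linked U a b) : Linked U b a := by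
  obtain rfl | ⟨c, hab, hbc, hac, h⟩ := h
  · exact Or.inl rfl
  · refine Or.inr ⟨c, hab.symm, hac, hbc, ?_⟩
    rw [← inv_mem_iff, cyc_inv, cyc_rotate hac.symm hab hbc.symm]
    exact h

theorem Linked.trans {a b c : α} (h₁ : Linked U a b) (h₂ : Linked U b c) : Linked U a c := by
  by_cases hab : a = b
  · rwa [hab]
  by_cases hbc : b = c
  · rwa [← hbc]
  by_cases hac : a = c
  · exact Or.inl hac
  have h := cyc_mem_of_linked hab hbc hac h₁ h₂
  rw [cyc_rotate hab hbc hac, cyc_rotate hbc (Ne.symm hac) (Ne.symm hab)] at h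
  exact Linked.symm (Or.inr ⟨b, Ne.symm hac, hab, Ne.symm hbc, h⟩)

theorem Linked.map {a b : α} {g : Perm α} (hg : g ∈ U) (h : Linked U a b) :
    Linked U (g a) (g b) := by
  obtain rfl | ⟨c, hab, hbc, hac, h⟩ := h
  · exact Or.inl rfl
  · refine Or.inr ⟨g c, g.injective.ne hab, g.injective.ne hbc, g.injective.ne hac, ?_⟩
    rw [← conj_cyc]
    exact conj_mem hg h

/-- Inserting (b c)(b c) splits the product into two products of transpositions sharing a point,
each of which is a three-cycle or the identity. -/
theorem swap_mul_swap_mem {s : Set α} (hs : ∀ a ∈ s, ∀ b ∈ s, Linked U a b) {a b c d : α}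
    (ha : a ∈ s) (hb : b ∈ s) (hc : c ∈ s) (hd : d ∈ s) (hab : a ≠ b) (hcd : c ≠ d) :
    swap a b * swap c d ∈ U := by
  have key : ∀ a ∈ s, ∀ b ∈ s, ∀ c ∈ s, a ≠ b → b ≠ c → swap a b * swap b c ∈ U := by
    intro a ha b hb c hc hab hbc
    by_cases hac : a = c
    · subst hac; rw [swap_comm b a, swap_mul_self]; exact U.one_mem
    · exact cyc_mem_of_linked hab hbc hac (hs a ha b hb) (hs b hb c hc)
  by_cases hbc : b = c
  · subst hbc
    exact key a ha b hb d hd hab hcd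
  · have h := U.mul_mem (key a ha b hb c hc hab hbc) (key b hb c hc d hd hbc hcd)
    rwa [mul_assoc, ← mul_assoc (swap b c), swap_mul_self, one_mul] at h

/-- If `g` and `h` in `U` move exactly one common point, this point is linked to another. -/
theorem exists_linked_of_common_moved {g h : Perm α} (hg : g ∈ U) (hh : h ∈ U) {x : α}
    (hgx : g x ≠ x) (hhx : h x ≠ x) (huniq : ∀ y, g y ≠ y → h y ≠ y → y = x) :
    ∃ y, y ≠ x ∧ Linked U x y := by
  refine ⟨g x, hgx, ?_⟩
  have hhgx : h (g x) = g x := by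
    by_contra hne
    exact hgx (huniq _ (g.injective.ne hgx) hne)
  have hghx : g (h x) = h x := by
    by_contra hne
    exact hhx (huniq _ hne (h.injective.ne hhx))
  have hne : g x ≠ h x := fun e => hgx (g.injective (by rw [e, hghx]))
  -- The commutator of two permutations whose supports meet in a single point is a three-cycle.
  have e : g * h * g⁻¹ * h⁻¹ = cyc x (g x) (h x) := by
    rw [mul_inv_eq_iff_eq_mul, mul_inv_eq_iff_eq_mul]
    ext y
    simp only [Perm.mul_apply]
    by_cases hy : y = x
    · subst hy
      rw [hghx, hhgx, (cyc_apply hgx.symm hne hhx.symm).2.1]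
    by_cases hgy : g y = y
    · rw [hgy]
      by_cases hyh : h y = x
      · rw [hyh, (cyc_apply hgx.symm hne hhx.symm).1]
      · have hh' : h y ≠ h x := h.injective.ne hy
        have hgy' : h y ≠ g x := fun e => by
          have : y = g x := h.injective (e.trans hhgx.symm)
          exact hgx (by rw [this] at hgy; exact g.injective hgy)
        rw [cyc_apply_of_ne hyh hgy' hh']
        by_contra hne'
        by_cases hhy : h y = y
        · rw [hhy] at hne'; exact hne' hgy
        · exact hyh (huniq _ hne' (h.injective.ne hhy))
    · have hhy : h y = y := by
        by_contra hhy
        exact hy (huniq _ hgy hhy)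
      have hhgy : h (g y) = if g y = x then h x else g y := by
        split_ifs with h'
        · rw [h']
        · by_contra hne'
          exact h' (huniq _ (g.injective.ne hgy) hne')
      rw [hhy, hhgy]
      split_ifs with h'
      · rw [h', (cyc_apply hgx.symm hne hhx.symm).2.2]
      · rw [cyc_apply_of_ne h' (g.injective.ne hy)]
        intro e
        exact hgy (by rw [e, g.injective (e.trans hghx.symm)])
  refine Or.inr ⟨h x, hgx.symm, hne, hhx.symm, ?_⟩
  rw [← e]
  exact U.mul_mem (conj_mem hg hh) (U.inv_mem hh)

end ThreeCycles

end SymExt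

/-! ### Numerical estimates. -/

namespace SymExt

open Equiv Equiv.Perm

/-- Add elements until the sum reaches T. If the last weight is itself at least T, it suffices
alone; otherwise the sum is below 2T ≤ n - T. -/
theorem exists_subset_sum_between {ι : Type*} [DecidableEq ι] (w : ι → ℕ) {n T : ℕ}
    (hT : 3 * T ≤ n) (s : Finset ι) (hw : ∀ i ∈ s, w i ≤ n - T) (hs : T ≤ ∑ i ∈ s, w i) :
    ∃ t ⊆ s, T ≤ ∑ i ∈ t, w i ∧ ∑ i ∈ t, w i ≤ n - T := by
  induction s using Finset.induction_on with
  | empty => exact ⟨∅, subset_rfl, hs, by simp⟩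
  | insert a s ha ih =>
    rw [Finset.sum_insert ha] at hs
    by_cases h : T ≤ ∑ i ∈ s, w i
    · obtain ⟨t, ht, h⟩ := ih (fun i hi => hw i (Finset.mem_insert_of_mem hi)) h
      exact ⟨t, ht.trans (Finset.subset_insert _ _), h⟩
    · by_cases h' : T ≤ w a
      · refine ⟨{a}, by simp, by simpa using h', by simpa using hw a (Finset.mem_insert_self _ _)⟩
      · refine ⟨insert a s, subset_rfl, ?_⟩
        rw [Finset.sum_insert ha]
        omega

theorem choose_le_choose_of_le_half {n j a : ℕ} (hja : j ≤ a) (ha : 2 * a ≤ n) :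
    n.choose j ≤ n.choose a := by
  induction a, hja using Nat.le_induction with
  | base => exact le_rfl
  | succ a _ ih => exact (ih (by omega)).trans (Nat.choose_le_succ_of_lt_half_left (by omega))

/-- Up to n/3, the ratio (n-T)/(T+1) of consecutive binomial coefficients is at least 2. -/
theorem choose_mul_two_pow_le {n k T : ℕ} (hkT : k ≤ T) (hT : 3 * T ≤ n) :
    n.choose k * 2 ^ (T - k) ≤ n.choose T := by
  induction T, hkT using Nat.le_induction with
  | base => simp
  | succ T hk ih =>
    have h := ih (by omega)
    have h2 : 2 * n.choose T ≤ n.choose (T + 1) := by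
      refine Nat.le_of_mul_le_mul_right ?_ (Nat.succ_pos T)
      rw [Nat.choose_succ_right_eq, mul_comm 2, mul_assoc]
      exact Nat.mul_le_mul_left _ (by omega)
    rw [Nat.succ_sub hk, pow_succ]
    linarith

theorem choose_mul_two_pow_le_choose {n k T a : ℕ} (hkT : k ≤ T) (hT : 3 * T ≤ n) (h₁ : T ≤ a)
    (h₂ : a ≤ n - T) : n.choose k * 2 ^ (T - k) ≤ n.choose a := by
  refine (choose_mul_two_pow_le hkT hT).trans ?_
  by_cases h : 2 * a ≤ n
  · exact choose_le_choose_of_le_half h₁ h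
  · rw [← Nat.choose_symm (show a ≤ n by omega)]
    exact choose_le_choose_of_le_half (by omega) (by omega)

theorem exists_forall_two_pow_le_factorial : ∃ t₀ : ℕ, ∀ t ≥ t₀, 2 ^ (48 * (t + 1)) ≤ t.factorial := by
  have h := FloorSemiring.tendsto_pow_div_factorial_atTop ((2 : ℝ) ^ 48)
  have h' := h.eventually_lt_const (show (0 : ℝ) < 1 / 2 ^ 48 by positivity)
  obtain ⟨t₀, ht₀⟩ := Filter.eventually_atTop.1 h'
  refine ⟨t₀, fun t ht => ?_⟩
  have h3 := ht₀ t ht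
  rw [div_lt_div_iff₀ (by positivity) (by positivity), one_mul] at h3
  have h4 : ((2 : ℝ)) ^ (48 * (t + 1)) ≤ t.factorial := by
    rw [pow_mul, pow_succ]
    exact h3.le
  exact_mod_cast h4

/-! ### Subgroups of small index in a symmetric group. -/

section Index

/-- Only the identity of `U` is supported in `s`. -/
def TrivialOn {α : Type*} (U : Subgroup (Perm α)) (s : Finset α) : Prop :=
  ∀ g ∈ U, (∀ x, x ∉ s → g x = x) → g = 1

open Classical in
theorem exists_max_trivialOn {α : Type*} [Fintype α] (U : Subgroup (Perm α)) :
    ∃ s : Finset α, TrivialOn U s ∧ ∀ t, TrivialOn U t → t.card ≤ s.card := by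
  obtain ⟨s, hs, hmax⟩ := Finset.exists_max_image
    ((Finset.univ : Finset (Finset α)).filter (TrivialOn U)) Finset.card
    ⟨∅, Finset.mem_filter.2 ⟨Finset.mem_univ _, fun g _ hg => Equiv.ext fun x => hg x (by simp)⟩⟩
  exact ⟨s, (Finset.mem_filter.1 hs).2, fun t ht => hmax t (by simpa using ht)⟩

variable {α : Type*} [Fintype α] [DecidableEq α]

theorem exists_perm_map_eq {A B : Finset α} (h : A.card = B.card) :
    ∃ g : Perm α, A.map g.toEmbedding = B := by
  obtain ⟨e⟩ : Nonempty ({x // x ∈ A} ≃ {x // x ∈ B}) := ⟨Finset.equivOfCardEq h⟩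
  refine ⟨e.extendSubtype, Finset.eq_of_subset_of_card_le ?_ (by simp [h])⟩
  intro x hx
  obtain ⟨a, ha, rfl⟩ := Finset.mem_map.1 hx
  exact e.extendSubtype_mem a ha

/-- Every set of size |A| is an image of A, and the permutations in one coset of U produce at most
|𝒜| images. -/
theorem choose_le_index_mul_card (U : Subgroup (Perm α)) (A : Finset α) (𝒜 : Finset (Finset α))
    (h : ∀ g ∈ U, A.map g.toEmbedding ∈ 𝒜) :
    (Fintype.card α).choose A.card ≤ U.index * 𝒜.card := by
  classical
  have hsub : Finset.powersetCard A.card (Finset.univ : Finset α) ⊆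
      (Finset.univ : Finset (Perm α ⧸ U)).biUnion
        fun q => 𝒜.image fun B => B.map q.out.toEmbedding := by
    intro B hB
    obtain ⟨g, hg⟩ := exists_perm_map_eq (Finset.mem_powersetCard.1 hB).2.symm
    simp only [Finset.mem_biUnion, Finset.mem_univ, true_and, Finset.mem_image]
    refine ⟨(g : Perm α ⧸ U), A.map ((g : Perm α ⧸ U).out⁻¹ * g).toEmbedding, h _ ?_, ?_⟩
    · rw [← QuotientGroup.eq, QuotientGroup.out_eq']
    · rw [← hg, Finset.map_map]
      congr 1
      ext x
      simp
  have h1 := Finset.card_le_card hsub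
  rw [Finset.card_powersetCard, Finset.card_univ] at h1
  refine h1.trans ?_
  refine (Finset.card_biUnion_le_card_mul _ _ 𝒜.card fun q _ => Finset.card_image_le).trans ?_
  rw [Finset.card_univ, ← Nat.card_eq_fintype_card]
  rfl

/-- Distinct permutations supported in s lie in distinct cosets of U. -/
theorem TrivialOn.factorial_le_index {U : Subgroup (Perm α)} {s : Finset α} (h : TrivialOn U s) :
    s.card.factorial ≤ U.index := by
  classical
  have hinj : Function.Injective fun σ : Perm {x // x ∈ s} => (ofSubtype σ : Perm α ⧸ U) := by
    intro σ τ hστ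
    have h1 := QuotientGroup.eq.1 hστ
    rw [← map_inv, ← map_mul] at h1
    have h2 := h _ h1 fun x hx => ofSubtype_apply_of_not_mem _ hx
    exact inv_mul_eq_one.1 (ofSubtype_injective (h2.trans (map_one _).symm))
  have h2 := Fintype.card_le_of_injective _ hinj
  rw [Fintype.card_perm, Fintype.card_coe, ← Nat.card_eq_fintype_card (α := Perm α ⧸ U)] at h2
  exact h2

/-- Suppose that g in U is supported in t and moves x. By maximality of s, some h in U supported in
s ∪ {x} moves x as well. The two supports meet only in x, so x is linked to another point. -/
theorem trivialOn_of_not_linked {U : Subgroup (Perm α)} {s t : Finset α} (hs : TrivialOn U s)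
    (hmax : ∀ t, TrivialOn U t → t.card ≤ s.card) (hst : Disjoint t s)
    (ht : ∀ x ∈ t, ∀ y, Linked U x y → y = x) : TrivialOn U t := by
  intro g hg hgt
  by_contra hne
  obtain ⟨x, hx⟩ : ∃ x, g x ≠ x := by
    by_contra! h
    exact hne (Equiv.ext h)
  have hxt : x ∈ t := by
    by_contra h
    exact hx (hgt x h)
  have hxs : x ∉ s := fun h => Finset.disjoint_left.1 hst hxt h
  have hins : ¬ TrivialOn U (insert x s) := fun h => by
    have := hmax _ h
    rw [Finset.card_insert_of_notMem hxs] at this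
    omega
  unfold TrivialOn at hins
  push Not at hins
  obtain ⟨h, hhU, hh, hh1⟩ := hins
  have hhx : h x ≠ x := fun e => hh1 (hs h hhU fun y hy => by
    by_cases hyx : y = x
    · rw [hyx, e]
    · exact hh y (by simp [hyx, hy]))
  obtain ⟨y, hyx, hy⟩ := exists_linked_of_common_moved hg hhU hx hhx fun y hgy hhy => by
    have h1 : y ∈ t := by
      by_contra h
      exact hgy (hgt y h)
    have h2 : y ∈ insert x s := by
      by_contra h
      exact hhy (hh y h)
    rcases Finset.mem_insert.1 h2 with h2 | h2
    · exact h2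
    · exact absurd h2 (Finset.disjoint_left.1 hst h1)
  exact hyx (ht x hxt y hy)

open Classical in
/-- The class of points linked to `x`. -/
noncomputable def linkClass (U : Subgroup (Perm α)) (x : α) : Finset α :=
  Finset.univ.filter (Linked U x)

theorem mem_linkClass {U : Subgroup (Perm α)} {x y : α} : y ∈ linkClass U x ↔ Linked U x y := by
  simp [linkClass]

theorem linkClass_eq_iff {U : Subgroup (Perm α)} {x y : α} :
    linkClass U x = linkClass U y ↔ Linked U x y := by
  constructor
  · intro h
    have : y ∈ linkClass U y := mem_linkClass.2 (Or.inl rfl)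
    rw [← h] at this
    exact mem_linkClass.1 this
  · intro h
    ext z
    rw [mem_linkClass, mem_linkClass]
    exact ⟨fun h' => h.symm.trans h', fun h' => h.trans h'⟩

theorem map_linkClass {U : Subgroup (Perm α)} {g : Perm α} (hg : g ∈ U) (x : α) :
    (linkClass U x).map g.toEmbedding = linkClass U (g x) := by
  ext y
  rw [Finset.mem_map, mem_linkClass]
  constructor
  · rintro ⟨z, hz, rfl⟩
    exact (mem_linkClass.1 hz).map hg
  · intro h
    refine ⟨g⁻¹ y, mem_linkClass.2 ?_, by simp⟩
    simpa using h.map (U.inv_mem hg)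

/-- The classes of linked points with at least two elements. -/
noncomputable def linkClasses (U : Subgroup (Perm α)) : Finset (Finset α) :=
  (Finset.univ.image (linkClass U)).filter fun C => 1 < C.card

theorem map_mem_linkClasses {U : Subgroup (Perm α)} {g : Perm α} (hg : g ∈ U) {C : Finset α}
    (hC : C ∈ linkClasses U) : C.map g.toEmbedding ∈ linkClasses U := by
  simp only [linkClasses, Finset.mem_filter, Finset.mem_image, Finset.mem_univ, true_and] at hC ⊢
  obtain ⟨⟨x, rfl⟩, h⟩ := hC
  exact ⟨⟨g x, (map_linkClass hg x).symm⟩, by simpa using h⟩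

theorem disjoint_linkClasses {U : Subgroup (Perm α)} {C D : Finset α} (hC : C ∈ linkClasses U)
    (hD : D ∈ linkClasses U) (hne : C ≠ D) : Disjoint C D := by
  simp only [linkClasses, Finset.mem_filter, Finset.mem_image, Finset.mem_univ, true_and] at hC hD
  obtain ⟨⟨x, rfl⟩, -⟩ := hC
  obtain ⟨⟨y, rfl⟩, -⟩ := hD
  rw [Finset.disjoint_left]
  intro z hz hz'
  exact hne (linkClass_eq_iff.2 ((mem_linkClass.1 hz).trans (mem_linkClass.1 hz').symm))

/-- A system of representatives of the classes supports no nontrivial g in U. If g moves the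
representative x, then g fixes any other point y of the class of x, so g x is linked to y. Hence g x
is a representative of the same class, that is, x itself. -/
theorem card_linkClasses_le {U : Subgroup (Perm α)} {N : ℕ}
    (hN : ∀ t, TrivialOn U t → t.card ≤ N) : (linkClasses U).card ≤ N := by
  classical
  rcases isEmpty_or_nonempty α with h | h
  · simp [linkClasses]
  have hne : ∀ C ∈ linkClasses U, ∃ x, linkClass U x = C := fun C hC => by
    simpa [linkClasses] using (Finset.mem_filter.1 hC).1
  choose! r hr using hne
  have hinj : Set.InjOn r (linkClasses U) := fun C hC D hD h => by
    rw [← hr C hC, h, hr D hD]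
  have hcard : ((linkClasses U).image r).card = (linkClasses U).card :=
    Finset.card_image_of_injOn hinj
  rw [← hcard]
  refine hN ((linkClasses U).image r) fun g hg hfix => ?_
  by_contra hg1
  obtain ⟨x, hx⟩ : ∃ x, g x ≠ x := by
    by_contra! h
    exact hg1 (Equiv.ext h)
  have hsupp : ∀ y, g y ≠ y → ∃ C ∈ linkClasses U, r C = y := fun y hy => by
    by_contra h
    exact hy (hfix y fun hy' => h (Finset.mem_image.1 hy'))
  obtain ⟨C, hC, hCx⟩ := hsupp x hx
  obtain ⟨D, hD, hDx⟩ := hsupp (g x) (g.injective.ne hx)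
  obtain ⟨y, hy, hyx⟩ := Finset.exists_mem_ne (Finset.mem_filter.1 hC).2 x
  have hxy : Linked U x y := by
    rw [← hr C hC, hCx] at hy
    exact mem_linkClass.1 hy
  have hgy : g y = y := by
    by_contra h
    obtain ⟨E, hE, hEy⟩ := hsupp y h
    have : E = C := by
      rw [← hr E hE, ← hr C hC, hCx, hEy]
      exact linkClass_eq_iff.2 hxy.symm
    exact hyx (by rw [← hEy, this, hCx])
  have hl : Linked U (g x) x := by
    have := hxy.map hg
    rw [hgy] at this
    exact this.trans hxy.symm
  have : D = C := by
    rw [← hr C hC, ← hr D hD, hCx, hDx]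
    exact linkClass_eq_iff.2 hl
  exact hx (by rw [← hDx, this, hCx])

/-- The points linked only to themselves number at most 2N: at most N lie in s, and those outside s
form a set on which U is trivial. -/
theorem card_le_sum_linkClasses {U : Subgroup (Perm α)} {N : ℕ} {s : Finset α}
    (hs : TrivialOn U s) (hN : s.card = N) (hmax : ∀ t, TrivialOn U t → t.card ≤ N) :
    Fintype.card α ≤ ∑ C ∈ linkClasses U, C.card + 2 * N := by
  classical
  subst hN
  set S : Finset α := Finset.univ.filter fun x => ∀ y, Linked U x y → y = x with hS
  have h1 : (S \ s).card ≤ s.card := hmax _ (trivialOn_of_not_linked hs hmax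
    Finset.sdiff_disjoint fun x hx => (Finset.mem_filter.1 (Finset.mem_sdiff.1 hx).1).2)
  have h2 : (Finset.univ : Finset α) ⊆ (linkClasses U).biUnion id ∪ (S \ s ∪ s) := by
    intro x _
    by_cases hx : x ∈ S
    · apply Finset.mem_union_right
      by_cases hxs : x ∈ s <;> simp [hx, hxs]
    · apply Finset.mem_union_left
      simp only [hS, Finset.mem_filter, Finset.mem_univ, true_and, not_forall] at hx
      obtain ⟨y, hxy, hyx⟩ := hx
      simp only [Finset.mem_biUnion, id]
      refine ⟨linkClass U x, ?_, mem_linkClass.2 (Or.inl rfl)⟩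
      simp only [linkClasses, Finset.mem_filter, Finset.mem_image, Finset.mem_univ, true_and]
      exact ⟨⟨x, rfl⟩, Finset.one_lt_card.2
        ⟨x, mem_linkClass.2 (Or.inl rfl), y, mem_linkClass.2 hxy, Ne.symm hyx⟩⟩
  have h3 := Finset.card_le_card h2
  have h4 := Finset.card_union_le ((linkClasses U).biUnion id) (S \ s ∪ s)
  have h5 := Finset.card_union_le (S \ s) s
  have h6 : ((linkClasses U).biUnion id).card ≤ ∑ C ∈ linkClasses U, C.card :=
    Finset.card_biUnion_le
  rw [Finset.card_univ] at h3
  omega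

/-- A subgroup of small index in a symmetric group contains all the even permutations fixing
some small set pointwise. -/
theorem exists_small_set_of_index_lt : ∃ n₀ : ℕ, ∀ (α : Type) [Fintype α] [DecidableEq α],
    n₀ ≤ Fintype.card α → ∀ k : ℕ, 4 * k < Fintype.card α → ∀ U : Subgroup (Perm α),
    U.index < (Fintype.card α).choose k →
      ∃ W : Finset α, W.card ≤ k ∧ ∀ a b c d : α, a ∉ W → b ∉ W → c ∉ W → d ∉ W → a ≠ b → c ≠ d →
        swap a b * swap c d ∈ U := by
  obtain ⟨t₀, ht₀⟩ := exists_forall_two_pow_le_factorial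
  refine ⟨48 * t₀ + 48, fun α _ _ hn k hk U hU => ?_⟩
  set n := Fintype.card α with hn'
  obtain ⟨s, hs, hmax⟩ := exists_max_trivialOn U
  -- Otherwise the index is at least (n/48)!, which exceeds 2^n ≥ C(n,k) or equals it. This makes
  -- both the number of classes and the number of unlinked points a small fraction of n.
  have hD : 48 * s.card + 48 ≤ n := by
    by_contra! hlt
    have h1 : n / 48 ≤ s.card := by omega
    have h2 := ht₀ (n / 48) (by omega)
    have h3 := Nat.factorial_le h1
    have h4 := hs.factorial_le_index
    have h5 : n.choose k ≤ 2 ^ n := Nat.choose_le_two_pow n k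
    have h6 : 2 ^ n ≤ 2 ^ (48 * (n / 48 + 1)) := Nat.pow_le_pow_right (by norm_num) (by omega)
    omega
  have hcard := card_le_sum_linkClasses hs rfl hmax
  have hr := card_linkClasses_le hmax
  -- A class with more than half of the points meets each of its images under U and is therefore
  -- invariant. Counting its images in the full symmetric group bounds its complement, which serves
  -- as W.
  by_cases hbig : ∃ C ∈ linkClasses U, n < 2 * C.card
  · obtain ⟨C, hC, hCn⟩ := hbig
    have hinv : ∀ g ∈ U, C.map g.toEmbedding ∈ ({C} : Finset (Finset α)) := fun g hg => by
      rw [Finset.mem_singleton]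
      by_contra hne
      have h1 := disjoint_linkClasses (map_mem_linkClasses hg hC) hC hne
      have h2 := Finset.card_union_of_disjoint h1
      have h3 := Finset.card_le_univ (C.map g.toEmbedding ∪ C)
      rw [Finset.card_map] at h2
      omega
    have h1 := choose_le_index_mul_card U C _ hinv
    rw [Finset.card_singleton, mul_one] at h1
    have hCle : C.card ≤ n := Finset.card_le_univ C
    refine ⟨Cᶜ, ?_, ?_⟩
    · rw [Finset.card_compl, ← hn']
      by_contra! hlt
      rw [← hn', ← Nat.choose_symm hCle] at h1
      have := choose_le_choose_of_le_half hlt.le (show 2 * (n - C.card) ≤ n by omega)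
      omega
    · intro a b c d ha hb hc hd hab hcd
      simp only [Finset.mem_compl, not_not] at ha hb hc hd
      refine swap_mul_swap_mem (s := (C : Set α)) ?_ ha hb hc hd hab hcd
      intro x hx y hy
      simp only [linkClasses, Finset.mem_filter, Finset.mem_image, Finset.mem_univ,
        true_and] at hC
      obtain ⟨⟨z, rfl⟩, -⟩ := hC
      exact (mem_linkClass.1 hx).symm.trans (mem_linkClass.1 hy)
  -- Without a majority class, some union of classes has size between n/3 and 2n/3, up to rounding.
  -- Its images under U are again unions of classes, at most 2^|s| in number. Since n/3 - k is about
  -- n/12 or more, this forces an index of at least C(n,k).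
  · exfalso
    push Not at hbig
    obtain ⟨t, ht, h1, h2⟩ := exists_subset_sum_between Finset.card (T := n / 3) (n := n)
      (by omega) (linkClasses U) (fun C hC => by have := hbig C hC; omega) (by omega)
    have hdisj : (t : Set (Finset α)).PairwiseDisjoint id := fun C hC D hD hne =>
      disjoint_linkClasses (ht hC) (ht hD) hne
    have hc := Finset.card_biUnion hdisj
    simp only [id] at hc
    have h3 := choose_le_index_mul_card U (t.biUnion id)
      ((linkClasses U).powerset.image fun r => r.biUnion id) (fun g hg => by
        rw [Finset.mem_image]
        refine ⟨t.image fun C => C.map g.toEmbedding, ?_, ?_⟩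
        · rw [Finset.mem_powerset]
          intro C hC
          obtain ⟨D, hD, rfl⟩ := Finset.mem_image.1 hC
          exact map_mem_linkClasses hg (ht hD)
        · rw [Finset.image_biUnion]
          ext x
          simp only [Finset.mem_biUnion, Finset.mem_map, id]
          constructor
          · rintro ⟨C, hC, y, hy, rfl⟩
            exact ⟨y, ⟨C, hC, hy⟩, rfl⟩
          · rintro ⟨y, ⟨C, hC, hy⟩, rfl⟩
            exact ⟨C, hC, y, hy, rfl⟩)
    have h4 : ((linkClasses U).powerset.image fun r => r.biUnion id).card ≤ 2 ^ s.card := by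
      refine Finset.card_image_le.trans ?_
      rw [Finset.card_powerset]
      exact Nat.pow_le_pow_right (by norm_num) hr
    have h5 := choose_mul_two_pow_le_choose (n := n) (k := k) (T := n / 3) (a := (t.biUnion id).card)
      (by omega) (by omega) (by rw [hc]; exact h1) (by rw [hc]; exact h2)
    have h6 : 2 ^ s.card ≤ 2 ^ (n / 3 - k) := Nat.pow_le_pow_right (by norm_num) (by omega)
    have h7 : U.index * 2 ^ s.card < n.choose k * 2 ^ s.card :=
      Nat.mul_lt_mul_of_pos_right hU (by positivity)
    have h8 := Nat.mul_le_mul_left U.index h4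
    have h9 := Nat.mul_le_mul_left (n.choose k) h6
    rw [← hn'] at h3
    omega

end Index

end SymExt

namespace SymExt

/-! ### Facets of polyhedra and their slack functions. -/

section Polyhedra

variable {d : ℕ}

theorem IsFacet.exists_functional {Q F : Set (RSpace d)} (hF : IsFacet Q F) :
    ∃ (l : StrongDual ℝ (RSpace d)) (m : ℝ), F = {y ∈ Q | l y = m} ∧ (∀ y ∈ Q, l y ≤ m) ∧
      ∃ y ∈ Q, l y < m := by
  obtain ⟨⟨x, hx⟩, hexp, hdim⟩ := hF
  obtain ⟨l, hl⟩ := hexp ⟨x, hx⟩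
  have hx' := hx
  rw [hl] at hx'
  have hFeq : F = {y ∈ Q | l y = l x} := by
    rw [hl]
    ext y
    constructor
    · exact fun hy => ⟨hy.1, le_antisymm (hx'.2 y hy.1) (hy.2 x hx'.1)⟩
    · exact fun hy => ⟨hy.1, fun z hz => (hx'.2 z hz).trans hy.2.ge⟩
  refine ⟨l, l x, hFeq, hx'.2, ?_⟩
  by_contra! hcon
  have : F = Q := by
    rw [hFeq]
    ext y
    exact ⟨fun hy => hy.1, fun hy => ⟨hy, le_antisymm (hx'.2 y hy) (hcon y hy)⟩⟩
  rw [this] at hdim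
  omega

/-- The functional is not constant on the affine hull of Q, so its level set there has dimension at
most dim F and cannot be larger than the hull of F. -/
theorem mem_affineSpan_facet {Q F : Set (RSpace d)} (hF : F.Nonempty) (hFQ : F ⊆ Q)
    (hdim : Module.finrank ℝ (affineSpan ℝ F).direction + 1 =
      Module.finrank ℝ (affineSpan ℝ Q).direction)
    {l : StrongDual ℝ (RSpace d)} {m : ℝ} (hl : ∀ y ∈ F, l y = m) (hne : ∃ y ∈ Q, l y ≠ m)
    (y : RSpace d) : y ∈ affineSpan ℝ F ↔ y ∈ affineSpan ℝ Q ∧ l y = m := by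
  obtain ⟨x, hx⟩ := hF
  obtain ⟨z, hz, hzm⟩ := hne
  have hxS : x ∈ affineSpan ℝ Q := subset_affineSpan ℝ _ (hFQ hx)
  have hzS : z ∈ affineSpan ℝ Q := subset_affineSpan ℝ _ hz
  set K : Submodule ℝ (RSpace d) := (affineSpan ℝ Q).direction ⊓ LinearMap.ker l.toLinearMap with hK
  have hle : (affineSpan ℝ F).direction ≤ K := by
    refine le_inf (AffineSubspace.direction_le (affineSpan_mono ℝ hFQ)) ?_
    rw [direction_affineSpan, vectorSpan_def, Submodule.span_le]
    rintro _ ⟨u, hu, v, hv, rfl⟩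
    simp [hl u hu, hl v hv]
  have hlt : K < (affineSpan ℝ Q).direction := by
    refine lt_of_le_of_ne inf_le_left fun h => hzm ?_
    have h1 : z -ᵥ x ∈ (affineSpan ℝ Q).direction := AffineSubspace.vsub_mem_direction hzS hxS
    rw [← h] at h1
    have h2 : l (z - x) = 0 := h1.2
    rw [map_sub, hl x hx] at h2
    linarith
  have hlt' := Submodule.finrank_lt_finrank_of_lt hlt
  have heq : (affineSpan ℝ F).direction = K :=
    Submodule.eq_of_le_of_finrank_le hle (by omega)
  rw [← AffineSubspace.vsub_right_mem_direction_iff_mem (subset_affineSpan ℝ _ hx), heq, hK,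
    Submodule.mem_inf, AffineSubspace.vsub_right_mem_direction_iff_mem hxS]
  simp [hl x hx, sub_eq_zero]

/-- The Riesz representative w of the functional restricted to the direction of S is the normal
vector of H within S. The foot of the perpendicular gives one bound and Cauchy–Schwarz the other,
with c = 1/‖w‖. -/
theorem exists_infDist_eq {S : AffineSubspace ℝ (RSpace d)} {H : Set (RSpace d)}
    {l : StrongDual ℝ (RSpace d)} {m : ℝ} (hH : ∀ y, y ∈ H ↔ y ∈ S ∧ l y = m) {x z : RSpace d}
    (hx : x ∈ S) (hxm : l x = m) (hz : z ∈ S) (hzm : l z ≠ m) :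
    ∃ c : ℝ, 0 < c ∧ ∀ y ∈ S, Metric.infDist y H = c * |m - l y| := by
  set w : S.direction := (InnerProductSpace.toDual ℝ S.direction).symm
    (l.comp S.direction.subtypeL) with hw
  have hwl : ∀ v ∈ S.direction, inner ℝ (w : RSpace d) v = l v := fun v hv => by
    have h := InnerProductSpace.toDual_symm_apply (𝕜 := ℝ) (x := (⟨v, hv⟩ : S.direction))
      (y := l.comp S.direction.subtypeL)
    rw [← hw] at h
    simpa using h
  have hwpos : 0 < ‖(w : RSpace d)‖ := by
    rw [norm_pos_iff]
    intro h0
    have h := hwl (z -ᵥ x) (AffineSubspace.vsub_mem_direction hz hx)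
    rw [h0, inner_zero_left, vsub_eq_sub, map_sub, hxm] at h
    exact hzm (by linarith)
  have hww : l (w : RSpace d) = ‖(w : RSpace d)‖ ^ 2 := by
    rw [← hwl _ w.2, real_inner_self_eq_norm_sq]
  refine ⟨‖(w : RSpace d)‖⁻¹, inv_pos.2 hwpos, fun y hy => le_antisymm ?_ ?_⟩
  · set f : RSpace d := ((m - l y) / ‖(w : RSpace d)‖ ^ 2) • (w : RSpace d) + y with hf
    have hfH : f ∈ H := by
      refine (hH f).2 ⟨?_, ?_⟩
      · exact AffineSubspace.vadd_mem_of_mem_direction (S.direction.smul_mem _ w.2) hy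
      · rw [hf, map_add, map_smul, hww, smul_eq_mul]
        field_simp
        ring
    refine (Metric.infDist_le_dist_of_mem hfH).trans_eq ?_
    rw [dist_comm, dist_eq_norm, hf, add_sub_cancel_right, norm_smul, Real.norm_eq_abs, abs_div,
      abs_of_pos (pow_pos hwpos 2)]
    field_simp
  · refine (Metric.le_infDist ⟨x, (hH x).2 ⟨hx, hxm⟩⟩).2 fun h hh => ?_
    obtain ⟨hhS, hhm⟩ := (hH h).1 hh
    have h1 := hwl (h -ᵥ y) (AffineSubspace.vsub_mem_direction hhS hy)
    rw [vsub_eq_sub, map_sub, hhm] at h1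
    rw [← h1, dist_comm, dist_eq_norm, inv_mul_le_iff₀ hwpos]
    exact abs_real_inner_le_norm _ _

/-- A facet of `Q` has a slack function that is affine and measures the distance on `Q`. -/
theorem IsFacet.exists_slack {Q F : Set (RSpace d)} (hF : IsFacet Q F)
    {l : StrongDual ℝ (RSpace d)} {m : ℝ} (hl : ∀ y ∈ F, l y = m) (hle : ∀ y ∈ Q, l y ≤ m)
    (hne : ∃ y ∈ Q, l y < m) :
    ∃ c : ℝ, 0 < c ∧ ∀ y ∈ Q, Metric.infDist y (affineSpan ℝ F) = c * (m - l y) := by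
  have hFQ : F ⊆ Q := by
    obtain ⟨l', m', h, -⟩ := hF.exists_functional
    rw [h]
    exact fun y hy => hy.1
  obtain ⟨x, hx⟩ := hF.1
  obtain ⟨z, hz, hzm⟩ := hne
  obtain ⟨c, hc, h⟩ := exists_infDist_eq (S := affineSpan ℝ Q) (H := affineSpan ℝ F) (l := l)
    (m := m) (mem_affineSpan_facet hF.1 hFQ hF.2.2 hl ⟨z, hz, hzm.ne⟩)
    (subset_affineSpan ℝ _ (hFQ hx)) (hl x hx) (subset_affineSpan ℝ _ hz) hzm.ne
  refine ⟨c, hc, fun y hy => ?_⟩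
  rw [h y (subset_affineSpan ℝ _ hy), abs_of_nonneg (by linarith [hle y hy])]

theorem exists_strict_point {ι : Type*} [DecidableEq ι] {F : Set (RSpace d)} (hF : Convex ℝ F)
    (hne : F.Nonempty) (a : ι → RSpace d) (b : ι → ℝ) (I : Finset ι)
    (hle : ∀ i ∈ I, ∀ y ∈ F, inner ℝ (a i) y ≤ b i) (hlt : ∀ i ∈ I, ∃ y ∈ F, inner ℝ (a i) y < b i) :
    ∃ y ∈ F, ∀ i ∈ I, inner ℝ (a i) y < b i := by
  induction I using Finset.induction_on with
  | empty => exact ⟨hne.some, hne.some_mem, by simp⟩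
  | insert i I hi ih =>
    obtain ⟨y, hy, h1⟩ := ih (fun j hj => hle j (Finset.mem_insert_of_mem hj))
      (fun j hj => hlt j (Finset.mem_insert_of_mem hj))
    obtain ⟨z, hz, h2⟩ := hlt i (Finset.mem_insert_self _ _)
    refine ⟨(1 / 2 : ℝ) • y + (1 / 2 : ℝ) • z,
      hF hy hz (by norm_num) (by norm_num) (by norm_num), fun j hj => ?_⟩
    rw [inner_add_right, inner_smul_right, inner_smul_right]
    rcases Finset.mem_insert.1 hj with rfl | hj'
    · linarith [hle j hj y hy]
    · linarith [hle j hj z hz, h1 j hj']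

theorem exists_pos_add_smul {ι : Type*} (a : ι → RSpace d) (b : ι → ℝ) (I : Finset ι)
    {y v : RSpace d} (hy : ∀ i ∈ I, inner ℝ (a i) y < b i) :
    ∃ ε : ℝ, 0 < ε ∧ ∀ i ∈ I, inner ℝ (a i) (ε • v + y) < b i := by
  have h : ∀ᶠ ε : ℝ in nhds 0, ∀ i ∈ I, inner ℝ (a i) (ε • v + y) < b i := by
    rw [Filter.eventually_all_finset]
    intro i hi
    have hc : Continuous fun ε : ℝ => inner ℝ (a i) (ε • v + y) := by fun_prop
    exact hc.continuousAt.eventually_lt_const (by simpa using hy i hi)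
  obtain ⟨δ, hδ, h⟩ := Metric.eventually_nhds_iff.1 h
  exact ⟨δ / 2, by positivity, h (by rw [Real.dist_eq, sub_zero, abs_of_pos (by positivity)]; linarith)⟩

/-- A subsystem of linear inequalities that describes `Q` within its affine hull and from which
no inequality can be dropped. -/
structure IsIrredundant {ι : Type*} (a : ι → RSpace d) (b : ι → ℝ) (Q : Set (RSpace d))
    (I : Finset ι) : Prop where
  mem_iff : ∀ y, y ∈ Q ↔ y ∈ affineSpan ℝ Q ∧ ∀ i ∈ I, inner ℝ (a i) y ≤ b i
  exists_violating : ∀ i ∈ I, ∃ z ∈ affineSpan ℝ Q, b i < inner ℝ (a i) z ∧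
    ∀ j ∈ I, j ≠ i → inner ℝ (a j) z ≤ b j

/-- A describing subsystem of minimum cardinality has the required property. -/
theorem IsPolyhedron.exists_irredundant {Q : Set (RSpace d)} (hQ : IsPolyhedron Q) :
    ∃ (k : ℕ) (a : Fin k → RSpace d) (b : Fin k → ℝ) (I : Finset (Fin k)),
      IsIrredundant a b Q I := by
  classical
  obtain ⟨k, a, b, hQ⟩ := hQ
  obtain ⟨I, hI, hmin⟩ := Finset.exists_min_image
    ((Finset.univ : Finset (Finset (Fin k))).filter fun I =>
      ∀ y, y ∈ Q ↔ y ∈ affineSpan ℝ Q ∧ ∀ i ∈ I, inner ℝ (a i) y ≤ b i) Finset.card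
    ⟨Finset.univ, Finset.mem_filter.2 ⟨Finset.mem_univ _, fun y =>
      ⟨fun hy => ⟨subset_affineSpan ℝ _ hy, fun i _ => by rw [hQ] at hy; exact hy i⟩,
        fun hy => by rw [hQ]; exact fun i => hy.2 i (Finset.mem_univ _)⟩⟩⟩
  replace hI := (Finset.mem_filter.1 hI).2
  refine ⟨k, a, b, I, hI, fun i hi => ?_⟩
  by_contra! hcon
  have h := hmin (I.erase i) (Finset.mem_filter.2 ⟨Finset.mem_univ _, fun y => ?_⟩)
  · have := Finset.card_erase_lt_of_mem hi
    omega
  · rw [hI y]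
    refine and_congr_right fun hy => ⟨fun h j hj => h j (Finset.mem_of_mem_erase hj), fun h j hj => ?_⟩
    by_cases hji : j = i
    · subst hji
      by_contra! hlt
      obtain ⟨l, hl, hli, hlt'⟩ := hcon y hy hlt
      exact absurd (h l (Finset.mem_erase.2 ⟨hli, hl⟩)) (not_le.2 hlt')
    · exact h j (Finset.mem_erase.2 ⟨hji, hj⟩)

namespace IsIrredundant

variable {ι : Type*} {a : ι → RSpace d} {b : ι → ℝ} {Q : Set (RSpace d)} {I : Finset ι}

theorem exists_strict (h : IsIrredundant a b Q I) {i : ι} (hi : i ∈ I) :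
    ∃ y ∈ Q, inner ℝ (a i) y < b i := by
  by_contra! hcon
  obtain ⟨z, hz, hzi, -⟩ := h.exists_violating i hi
  have hsub : ∀ y ∈ Q, innerSL ℝ (a i) y = b i := fun y hy =>
    le_antisymm (((h.mem_iff y).1 hy).2 i hi) (hcon y hy)
  refine hzi.ne' ?_
  refine affineSpan_induction (p := fun y => inner ℝ (a i) y = b i) hz hsub fun c u v w hu hv hw => ?_
  simp only [vsub_eq_sub, vadd_eq_add, inner_add_right, inner_smul_right, inner_sub_right]
  rw [hu, hv, hw]
  ring

theorem convex (h : IsIrredundant a b Q I) : Convex ℝ Q := by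
  intro x hx y hy s t hs ht hst
  rw [h.mem_iff] at hx hy ⊢
  refine ⟨(affineSpan ℝ Q).convex hx.1 hy.1 hs ht hst, fun i hi => ?_⟩
  rw [inner_add_right, inner_smul_right, inner_smul_right]
  have h1 := mul_le_mul_of_nonneg_left (hx.2 i hi) hs
  have h2 := mul_le_mul_of_nonneg_left (hy.2 i hi) ht
  have h3 : s * b i + t * b i = b i := by rw [← add_mul, hst, one_mul]
  linarith

variable [DecidableEq ι]

/-- The segment from a point that is strict for all inequalities to a point violating only the i-th
crosses the i-th hyperplane at the desired point. -/
theorem exists_mem_facet (h : IsIrredundant a b Q I) (hne : Q.Nonempty) {i : ι} (hi : i ∈ I) :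
    ∃ w ∈ affineSpan ℝ Q, inner ℝ (a i) w = b i ∧ ∀ j ∈ I.erase i, inner ℝ (a j) w < b j := by
  obtain ⟨q, hq, hqlt⟩ := exists_strict_point h.convex hne a b I
    (fun i hi y hy => ((h.mem_iff y).1 hy).2 i hi) fun i hi => h.exists_strict hi
  obtain ⟨z, hz, hzi, hzj⟩ := h.exists_violating i hi
  have hqS : q ∈ affineSpan ℝ Q := subset_affineSpan ℝ _ hq
  have hqi := hqlt i hi
  set t : ℝ := (b i - inner ℝ (a i) q) / (inner ℝ (a i) z - inner ℝ (a i) q) with ht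
  have hden : 0 < inner ℝ (a i) z - inner ℝ (a i) q := by linarith
  have ht0 : 0 < t := div_pos (by linarith) hden
  have ht1 : t < 1 := by rw [ht, div_lt_one hden]; linarith
  set w : RSpace d := AffineMap.lineMap q z t with hw
  have hwS : w ∈ affineSpan ℝ Q := AffineMap.lineMap_mem t hqS hz
  have hwj : ∀ u : RSpace d, inner ℝ u w = inner ℝ u q + t * (inner ℝ u z - inner ℝ u q) := fun u => by
    rw [hw, AffineMap.lineMap_apply, vsub_eq_sub, vadd_eq_add, inner_add_right, inner_smul_right,
      inner_sub_right]
    ring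
  have hwi : inner ℝ (a i) w = b i := by
    rw [hwj, ht]
    field_simp
    ring
  refine ⟨w, hwS, hwi, fun j hj => ?_⟩
  have h1 := hqlt j (Finset.mem_of_mem_erase hj)
  have h2 := hzj j (Finset.mem_of_mem_erase hj) (Finset.ne_of_mem_erase hj)
  rw [hwj]
  nlinarith

/-- Around a point where only the i-th inequality is tight, small moves inside the hyperplane and
the affine hull stay in Q. The face thus spans the whole kernel of the i-th functional, of
codimension one. -/
theorem isFacet (h : IsIrredundant a b Q I) (hne : Q.Nonempty) {i : ι} (hi : i ∈ I) :
    IsFacet Q {y ∈ Q | inner ℝ (a i) y = b i} := by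
  obtain ⟨w, hwS, hwi, hwlt⟩ := h.exists_mem_facet hne hi
  obtain ⟨z, hz, hzi, hzj⟩ := h.exists_violating i hi
  have hmem : ∀ y ∈ affineSpan ℝ Q, inner ℝ (a i) y = b i → (∀ j ∈ I.erase i, inner ℝ (a j) y < b j) →
      y ∈ {y ∈ Q | inner ℝ (a i) y = b i} := fun y hy hyi hyj => by
    refine ⟨(h.mem_iff y).2 ⟨hy, fun j hj => ?_⟩, hyi⟩
    by_cases hji : j = i
    · rw [hji, hyi]
    · exact (hyj j (Finset.mem_erase.2 ⟨hji, hj⟩)).le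
  have hwF := hmem w hwS hwi hwlt
  refine ⟨⟨w, hwF⟩, fun _ => ⟨innerSL ℝ (a i), ?_⟩, ?_⟩
  · ext y
    simp only [Set.mem_ofPred_eq, innerSL_apply_apply]
    refine and_congr_right fun hy => ⟨fun hyi x hx => ?_, fun hy' => le_antisymm ?_ ?_⟩
    · rw [hyi]
      exact ((h.mem_iff x).1 hx).2 i hi
    · exact ((h.mem_iff y).1 hy).2 i hi
    · rw [← hwi]
      exact hy' w hwF.1
  · set L := (affineSpan ℝ Q).direction with hL
    set f : Module.Dual ℝ L := (innerSL ℝ (a i)).toLinearMap ∘ₗ L.subtype with hf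
    have hf0 : f ≠ 0 := fun h0 => by
      have h1 : f ⟨z -ᵥ w, AffineSubspace.vsub_mem_direction hz hwS⟩ = 0 := by rw [h0]; rfl
      have h2 : inner ℝ (a i) (z - w) = 0 := h1
      rw [inner_sub_right] at h2
      linarith
    rw [← Module.Dual.finrank_ker_add_one_of_ne_zero hf0,
      ← Submodule.finrank_map_subtype_eq L (LinearMap.ker f)]
    suffices hdir : (affineSpan ℝ {y ∈ Q | inner ℝ (a i) y = b i}).direction =
        Submodule.map L.subtype (LinearMap.ker f) by rw [hdir]
    refine le_antisymm ?_ ?_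
    · rw [direction_affineSpan, vectorSpan_def, Submodule.span_le]
      rintro _ ⟨u, hu, v, hv, rfl⟩
      refine ⟨⟨u -ᵥ v, AffineSubspace.vsub_mem_direction (subset_affineSpan ℝ _ hu.1)
        (subset_affineSpan ℝ _ hv.1)⟩, ?_, rfl⟩
      change inner ℝ (a i) (u - v) = 0
      rw [inner_sub_right, hu.2, hv.2, sub_self]
    · rintro _ ⟨⟨v, hv⟩, hv0, rfl⟩
      have hv0' : inner ℝ (a i) v = 0 := hv0
      obtain ⟨ε, hε, hεlt⟩ := exists_pos_add_smul a b (I.erase i) (v := v) hwlt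
      have h1 := hmem (ε • v + w) (AffineSubspace.vadd_mem_of_mem_direction (L.smul_mem _ hv) hwS)
        (by rw [inner_add_right, inner_smul_right, hv0', hwi]; ring) hεlt
      have h2 := AffineSubspace.vsub_mem_direction (subset_affineSpan ℝ _ h1)
        (subset_affineSpan ℝ _ hwF)
      rw [vsub_eq_sub, add_sub_cancel_right] at h2
      exact (Submodule.smul_mem_iff _ hε.ne').1 h2

theorem exists_eq_of_isFacet (h : IsIrredundant a b Q I) {F : Set (RSpace d)} (hF : IsFacet Q F) :
    ∃ i ∈ I, F = {y ∈ Q | inner ℝ (a i) y = b i} := by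
  obtain ⟨l, m, hFeq, hle, y, hy, hym⟩ := hF.exists_functional
  have hFQ : F ⊆ Q := by
    rw [hFeq]
    exact fun y hy => hy.1
  have hFconv : Convex ℝ F := by
    rw [hFeq]
    intro u hu v hv s t hs ht hst
    refine ⟨h.convex hu.1 hv.1 hs ht hst, ?_⟩
    rw [map_add, map_smul, map_smul, hu.2, hv.2, ← add_smul, hst, one_smul]
  -- If no inequality were tight on all of F, some f in F would be strict for all of them. Moving
  -- from f slightly away from a point y of Q off F would stay in Q while increasing the functional
  -- beyond its maximum.
  have hex : ∃ i ∈ I, ∀ f ∈ F, b i ≤ inner ℝ (a i) f := by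
    by_contra! hcon
    obtain ⟨f, hf, hflt⟩ := exists_strict_point hFconv hF.1 a b I
      (fun i hi y hy => ((h.mem_iff y).1 (hFQ hy)).2 i hi) hcon
    obtain ⟨ε, hε, hεlt⟩ := exists_pos_add_smul a b I (v := f - y) hflt
    have hfS : f ∈ affineSpan ℝ Q := subset_affineSpan ℝ _ (hFQ hf)
    have hmem : ε • (f - y) + f ∈ Q := (h.mem_iff _).2
      ⟨AffineSubspace.vadd_mem_of_mem_direction (Submodule.smul_mem _ _
        (AffineSubspace.vsub_mem_direction hfS (subset_affineSpan ℝ _ hy))) hfS,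
        fun i hi => (hεlt i hi).le⟩
    have h1 := hle _ hmem
    have h2 : l f = m := by
      rw [hFeq] at hf
      exact hf.2
    rw [map_add, map_smul, map_sub, h2, smul_eq_mul] at h1
    nlinarith
  obtain ⟨i, hi, hFi⟩ := hex
  refine ⟨i, hi, Set.Subset.antisymm (fun f hf => ⟨hFQ hf, le_antisymm
    (((h.mem_iff f).1 (hFQ hf)).2 i hi) (hFi f hf)⟩) fun f hf => ?_⟩
  obtain ⟨q, hq, hqi⟩ := h.exists_strict hi
  have h1 := (mem_affineSpan_facet hF.1 hFQ hF.2.2 (l := innerSL ℝ (a i)) (m := b i)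
    (fun f hf => le_antisymm (((h.mem_iff f).1 (hFQ hf)).2 i hi) (hFi f hf))
    ⟨q, hq, hqi.ne⟩ f).2 ⟨subset_affineSpan ℝ _ hf.1, hf.2⟩
  have h2 := (mem_affineSpan_facet hF.1 hFQ hF.2.2 (l := l) (m := m)
    (fun f hf => by rw [hFeq] at hf; exact hf.2) ⟨y, hy, hym.ne⟩ f).1 h1
  rw [hFeq]
  exact ⟨hf.1, h2.2⟩

end IsIrredundant

theorem IsPolyhedron.convex {Q : Set (RSpace d)} (hQ : IsPolyhedron Q) : Convex ℝ Q := by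
  obtain ⟨k, a, b, I, h⟩ := hQ.exists_irredundant
  exact h.convex

theorem IsPolyhedron.finite_facets {Q : Set (RSpace d)} (hQ : IsPolyhedron Q) :
    {F | IsFacet Q F}.Finite := by
  obtain ⟨k, a, b, I, h⟩ := hQ.exists_irredundant
  refine (I.finite_toSet.image fun i => {y ∈ Q | inner ℝ (a i) y = b i}).subset fun F hF => ?_
  obtain ⟨i, hi, rfl⟩ := h.exists_eq_of_isFacet hF
  exact ⟨i, hi, rfl⟩

/-- The slack functions of the facets of a polyhedron: they measure the distance to the
affine hull of the facet, and they describe the polyhedron within its affine hull. -/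
theorem IsPolyhedron.exists_slacks {Q : Set (RSpace d)} (hQ : IsPolyhedron Q) (hne : Q.Nonempty) :
    ∃ g : {F | IsFacet Q F} → RSpace d →ᵃ[ℝ] ℝ,
      (∀ F, ∀ y ∈ Q, g F y = Metric.infDist y (affineSpan ℝ (F : Set (RSpace d)))) ∧
      ∀ y ∈ affineSpan ℝ Q, (∀ F, 0 ≤ g F y) → y ∈ Q := by
  obtain ⟨k, a, b, I, h⟩ := hQ.exists_irredundant
  have hex : ∀ F : {F | IsFacet Q F}, ∃ (i : Fin k) (c : ℝ), i ∈ I ∧ 0 < c ∧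
      (F : Set (RSpace d)) = {y ∈ Q | inner ℝ (a i) y = b i} ∧
      ∀ y ∈ Q, Metric.infDist y (affineSpan ℝ (F : Set (RSpace d))) =
        c * (b i - innerSL ℝ (a i) y) := by
    rintro ⟨F, hF⟩
    obtain ⟨i, hi, hFi⟩ := h.exists_eq_of_isFacet hF
    obtain ⟨c, hc, hslack⟩ := IsFacet.exists_slack hF (l := innerSL ℝ (a i)) (m := b i)
      (fun y hy => by rw [hFi] at hy; exact hy.2)
      (fun y hy => ((h.mem_iff y).1 hy).2 i hi) (h.exists_strict hi)
    exact ⟨i, c, hi, hc, hFi, hslack⟩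
  choose i c hi hc hFi hslack using hex
  refine ⟨fun F => c F • (AffineMap.const ℝ _ (b (i F)) -
    (innerSL ℝ (a (i F))).toLinearMap.toAffineMap), fun F y hy => ?_, fun y hy hpos => ?_⟩
  · rw [hslack F y hy]
    simp
  · refine (h.mem_iff y).2 ⟨hy, fun j hj => ?_⟩
    set F : {F | IsFacet Q F} := ⟨{y ∈ Q | inner ℝ (a j) y = b j}, h.isFacet hne hj⟩ with hF
    -- At a point where only the j-th inequality is tight, no other inequality can define the same
    -- facet.
    have hij : i F = j := by
      by_contra hij
      obtain ⟨w, hwS, hwj, hwlt⟩ := h.exists_mem_facet hne hj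
      have hwQ : w ∈ Q := (h.mem_iff w).2 ⟨hwS, fun l hl => by
        by_cases hlj : l = j
        · rw [hlj, hwj]
        · exact (hwlt l (Finset.mem_erase.2 ⟨hlj, hl⟩)).le⟩
      have hwF : w ∈ (F : Set (RSpace d)) := ⟨hwQ, hwj⟩
      rw [hFi F] at hwF
      exact (hwlt _ (Finset.mem_erase.2 ⟨hij, hi F⟩)).ne hwF.2
    have h1 : 0 ≤ c F * (b (i F) - inner ℝ (a (i F)) y) := by simpa using hpos F
    rw [hij] at h1
    have h2 := nonneg_of_mul_nonneg_right h1 (hc F)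
    linarith

end Polyhedra

end SymExt

namespace SymExt

open Equiv Polynomial

/-! ### Edges and matchings of the complete graph. -/

section Edges

variable {n : ℕ}

/-- The edge joining two distinct nodes. -/
def mkEdge (u v : Fin n) (h : u ≠ v) : KEdge n := ⟨s(u, v), h⟩

theorem mem_mkEdge {u v x : Fin n} (h : u ≠ v) :
    x ∈ (mkEdge u v h : Sym2 (Fin n)) ↔ x = u ∨ x = v := by
  simp [mkEdge]

theorem exists_eq_mkEdge (e : KEdge n) : ∃ (u v : Fin n) (h : u ≠ v), e = mkEdge u v h := by
  obtain ⟨e, he⟩ := e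
  induction e with
  | _ u v => exact ⟨u, v, he, rfl⟩

theorem mkEdge_comm {u v : Fin n} (h : u ≠ v) : mkEdge u v h = mkEdge v u h.symm :=
  Subtype.ext Sym2.eq_swap

theorem edgePerm_mkEdge (π : Perm (Fin n)) {u v : Fin n} (h : u ≠ v) :
    edgePerm π (mkEdge u v h) = mkEdge (π u) (π v) (π.injective.ne h) := rfl

theorem edgePerm_mul (π τ : Perm (Fin n)) (e : KEdge n) :
    edgePerm (π * τ) e = edgePerm π (edgePerm τ e) := by
  obtain ⟨u, v, h, rfl⟩ := exists_eq_mkEdge e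
  rfl

theorem edgePerm_one (e : KEdge n) : edgePerm 1 e = e := by
  obtain ⟨u, v, h, rfl⟩ := exists_eq_mkEdge e
  rfl

theorem mem_edgePerm (π : Perm (Fin n)) (e : KEdge n) (x : Fin n) :
    π x ∈ (edgePerm π e : Sym2 (Fin n)) ↔ x ∈ (e : Sym2 (Fin n)) := by
  obtain ⟨u, v, h, rfl⟩ := exists_eq_mkEdge e
  rw [edgePerm_mkEdge, mem_mkEdge, mem_mkEdge, π.injective.eq_iff, π.injective.eq_iff]

theorem edgePerm_eq_self {π : Perm (Fin n)} {e : KEdge n}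
    (h : ∀ x ∈ (e : Sym2 (Fin n)), π x = x) : edgePerm π e = e := by
  obtain ⟨u, v, huv, rfl⟩ := exists_eq_mkEdge e
  have hu := h u ((mem_mkEdge huv).2 (Or.inl rfl))
  have hv := h v ((mem_mkEdge huv).2 (Or.inr rfl))
  simp only [edgePerm_mkEdge, hu, hv]

/-- The image of a set of edges under a permutation of the nodes. -/
def mapEdges (π : Perm (Fin n)) (M : Finset (KEdge n)) : Finset (KEdge n) :=
  M.map (edgePerm π).toEmbedding

theorem mem_mapEdges {π : Perm (Fin n)} {M : Finset (KEdge n)} {e : KEdge n} :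
    edgePerm π e ∈ mapEdges π M ↔ e ∈ M := by
  simp [mapEdges]

theorem exists_of_mem_mapEdges {π : Perm (Fin n)} {M : Finset (KEdge n)} {e : KEdge n}
    (h : e ∈ mapEdges π M) : ∃ f ∈ M, edgePerm π f = e := by
  obtain ⟨f, hf, h⟩ := Finset.mem_map.1 h
  exact ⟨f, hf, h⟩

theorem card_mapEdges (π : Perm (Fin n)) (M : Finset (KEdge n)) :
    (mapEdges π M).card = M.card := Finset.card_map _

theorem mapEdges_mul (π τ : Perm (Fin n)) (M : Finset (KEdge n)) :
    mapEdges (π * τ) M = mapEdges π (mapEdges τ M) := by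
  rw [mapEdges, mapEdges, mapEdges, Finset.map_map]
  congr 1
  ext1 e
  exact edgePerm_mul π τ e

theorem mapEdges_one (M : Finset (KEdge n)) : mapEdges 1 M = M := by
  ext e
  rw [← mem_mapEdges (π := 1) (M := M), edgePerm_one]

theorem IsMatching.eq_of_mem {M : Finset (KEdge n)} (hM : IsMatching M) {e f : KEdge n}
    (he : e ∈ M) (hf : f ∈ M) {v : Fin n} (hve : v ∈ (e : Sym2 (Fin n)))
    (hvf : v ∈ (f : Sym2 (Fin n))) : e = f := by
  by_contra h
  exact hM e he f hf h v ⟨hve, hvf⟩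

theorem isMatching_of {M : Finset (KEdge n)} (h : ∀ e ∈ M, ∀ f ∈ M, ∀ v : Fin n,
    v ∈ (e : Sym2 (Fin n)) → v ∈ (f : Sym2 (Fin n)) → e = f) : IsMatching M :=
  fun e he f hf hne v hv => hne (h e he f hf v hv.1 hv.2)

theorem IsMatching.mono {M N : Finset (KEdge n)} (hM : IsMatching M) (h : N ⊆ M) : IsMatching N :=
  fun e he f hf => hM e (h he) f (h hf)

theorem IsMatching.mapEdges {M : Finset (KEdge n)} (hM : IsMatching M) (π : Perm (Fin n)) :
    IsMatching (mapEdges π M) := by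
  refine isMatching_of fun e he f hf v hve hvf => ?_
  obtain ⟨e, he', rfl⟩ := exists_of_mem_mapEdges he
  obtain ⟨f, hf', rfl⟩ := exists_of_mem_mapEdges hf
  rw [← π.apply_symm_apply v, mem_edgePerm] at hve hvf
  rw [hM.eq_of_mem he' hf' hve hvf]

/-- The two pairs may overlap. Since w is the image of v under the first transposition, only the
four given nodes are ever moved. -/
theorem exists_perm_pair {u v u' v' : Fin n} (h : u ≠ v) (h' : u' ≠ v') :
    ∃ w : Fin n, (w = u ∨ w = v ∨ w = u' ∨ w = v') ∧
      (swap w v' * swap u u') u = u' ∧ (swap w v' * swap u u') v = v' := by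
  refine ⟨swap u u' v, ?_, ?_, ?_⟩
  · rw [swap_apply_def]
    split_ifs <;> simp
  · rw [Perm.mul_apply, swap_apply_left]
    refine swap_apply_of_ne_of_ne (fun e => h ?_) h'
    exact (swap u u').injective ((swap_apply_left u u').trans e)
  · simp

/-- The number of nodes of the edge `e` in `A`. -/
def endsIn (A : Finset (Fin n)) (e : KEdge n) : ℕ := (A.filter fun v => v ∈ (e : Sym2 (Fin n))).card

theorem endsIn_mkEdge (A : Finset (Fin n)) {u v : Fin n} (h : u ≠ v) :
    endsIn A (mkEdge u v h) = (if u ∈ A then 1 else 0) + if v ∈ A then 1 else 0 := by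
  have h1 : (A.filter fun x => x ∈ (mkEdge u v h : Sym2 (Fin n))) =
      (A.filter fun x => x = u) ∪ A.filter fun x => x = v := by
    ext x
    simp only [Finset.mem_filter, mem_mkEdge, Finset.mem_union]
    tauto
  rw [endsIn, h1, Finset.card_union_of_disjoint, Finset.filter_eq', Finset.filter_eq']
  · congr 1 <;> split_ifs <;> simp
  · rw [Finset.disjoint_left]
    intro x hx hx'
    exact h ((Finset.mem_filter.1 hx).2.symm.trans (Finset.mem_filter.1 hx').2)

theorem endsIn_edgePerm {A : Finset (Fin n)} {π : Perm (Fin n)} (h : ∀ x, π x ∈ A ↔ x ∈ A)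
    (e : KEdge n) : endsIn A (edgePerm π e) = endsIn A e := by
  obtain ⟨u, v, huv, rfl⟩ := exists_eq_mkEdge e
  rw [edgePerm_mkEdge, endsIn_mkEdge, endsIn_mkEdge]
  simp only [h]

theorem endsIn_le_two (A : Finset (Fin n)) (e : KEdge n) : endsIn A e ≤ 2 := by
  obtain ⟨u, v, huv, rfl⟩ := exists_eq_mkEdge e
  rw [endsIn_mkEdge]
  split_ifs <;> simp

/-- The nodes covered by the matching `M` are exactly those of `S`. -/
structure IsPerfectOn (S : Finset (Fin n)) (M : Finset (KEdge n)) : Prop where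
  isMatching : IsMatching M
  mem_iff : ∀ v, v ∈ S ↔ ∃ e ∈ M, v ∈ (e : Sym2 (Fin n))

theorem IsPerfectOn.sum_endsIn {S A : Finset (Fin n)} {M : Finset (KEdge n)}
    (hM : IsPerfectOn S M) (hA : A ⊆ S) : ∑ e ∈ M, endsIn A e = A.card := by
  have h1 : A = M.biUnion fun e => A.filter fun v => v ∈ (e : Sym2 (Fin n)) := by
    ext v
    simp only [Finset.mem_biUnion, Finset.mem_filter]
    constructor
    · intro hv
      obtain ⟨e, he, hve⟩ := (hM.mem_iff v).1 (hA hv)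
      exact ⟨e, he, hv, hve⟩
    · rintro ⟨e, -, hv, -⟩
      exact hv
  conv_rhs => rw [h1]
  rw [Finset.card_biUnion]
  · rfl
  · intro e he f hf hne
    refine Finset.disjoint_left.2 fun v hv hv' => ?_
    exact hne (hM.isMatching.eq_of_mem he hf (Finset.mem_filter.1 hv).2 (Finset.mem_filter.1 hv').2)

/-- The number of edges of `M` with exactly `t` nodes in `A`. -/
def numEnds (A : Finset (Fin n)) (t : ℕ) (M : Finset (KEdge n)) : ℕ :=
  (M.filter fun e => endsIn A e = t).card

theorem sum_endsIn_eq (A : Finset (Fin n)) (M : Finset (KEdge n)) :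
    ∑ e ∈ M, endsIn A e = numEnds A 1 M + 2 * numEnds A 2 M := by
  rw [numEnds, numEnds, Finset.card_filter, Finset.card_filter, Finset.mul_sum,
    ← Finset.sum_add_distrib]
  refine Finset.sum_congr rfl fun e _ => ?_
  have := endsIn_le_two A e
  interval_cases endsIn A e <;> simp

theorem card_eq_numEnds (A : Finset (Fin n)) (M : Finset (KEdge n)) :
    M.card = numEnds A 0 M + numEnds A 1 M + numEnds A 2 M := by
  rw [numEnds, numEnds, numEnds, Finset.card_filter, Finset.card_filter, Finset.card_filter,
    Finset.card_eq_sum_ones, ← Finset.sum_add_distrib, ← Finset.sum_add_distrib]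
  refine Finset.sum_congr rfl fun e _ => ?_
  have := endsIn_le_two A e
  interval_cases endsIn A e <;> simp

theorem IsPerfectOn.card_eq {S : Finset (Fin n)} {M : Finset (KEdge n)} (hM : IsPerfectOn S M) :
    2 * M.card = S.card := by
  rw [← hM.sum_endsIn subset_rfl, mul_comm, ← smul_eq_mul, ← Finset.sum_const]
  refine Finset.sum_congr rfl fun e he => ?_
  obtain ⟨u, v, huv, rfl⟩ := exists_eq_mkEdge e
  have hu := (hM.mem_iff u).2 ⟨_, he, (mem_mkEdge huv).2 (Or.inl rfl)⟩
  have hv := (hM.mem_iff v).2 ⟨_, he, (mem_mkEdge huv).2 (Or.inr rfl)⟩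
  rw [endsIn_mkEdge, if_pos hu, if_pos hv]

theorem IsPerfectOn.insert_mkEdge {S : Finset (Fin n)} {M : Finset (KEdge n)}
    (hM : IsPerfectOn S M) {u v : Fin n} (huv : u ≠ v) (hu : u ∉ S) (hv : v ∉ S) :
    IsPerfectOn (insert u (insert v S)) (insert (mkEdge u v huv) M) ∧ mkEdge u v huv ∉ M := by
  have hout : ∀ e ∈ M, ∀ x ∈ (e : Sym2 (Fin n)), x ∉ (mkEdge u v huv : Sym2 (Fin n)) :=
    fun e he x hx hx' => by
      have hxS := (hM.mem_iff x).2 ⟨e, he, hx⟩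
      rcases (mem_mkEdge huv).1 hx' with rfl | rfl
      · exact hu hxS
      · exact hv hxS
  refine ⟨⟨isMatching_of fun e he f hf x hxe hxf => ?_, fun x => ?_⟩, fun h =>
    hout _ h u ((mem_mkEdge huv).2 (Or.inl rfl)) ((mem_mkEdge huv).2 (Or.inl rfl))⟩
  · rcases Finset.mem_insert.1 he with rfl | he <;> rcases Finset.mem_insert.1 hf with rfl | hf
    · rfl
    · exact absurd hxe (hout f hf x hxf)
    · exact absurd hxf (hout e he x hxe)
    · exact hM.isMatching.eq_of_mem he hf hxe hxf
  · simp only [Finset.mem_insert, exists_eq_or_imp, mem_mkEdge, hM.mem_iff, or_assoc]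

theorem exists_isPerfectOn_of_pair {A S : Finset (Fin n)} {u v : Fin n} (huv : u ≠ v) (hu : u ∈ S)
    (hv : v ∈ S) {i : ℕ} (h : ∃ M, IsPerfectOn ((S.erase u).erase v) M ∧ numEnds A 1 M = i) :
    ∃ M, IsPerfectOn S M ∧
      numEnds A 1 M = i + if endsIn A (mkEdge u v huv) = 1 then 1 else 0 := by
  obtain ⟨M, hM, hi⟩ := h
  obtain ⟨h1, h2⟩ := hM.insert_mkEdge huv (by simp) (by simp)
  refine ⟨insert (mkEdge u v huv) M, ?_, ?_⟩
  · have : insert u (insert v ((S.erase u).erase v)) = S := by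
      rw [Finset.insert_erase (Finset.mem_erase.2 ⟨huv.symm, hv⟩), Finset.insert_erase hu]
    rwa [this] at h1
  · rw [numEnds, Finset.filter_insert]
    split_ifs with h
    · rw [Finset.card_insert_of_notMem (by simp [h2]), ← hi, numEnds]
    · rw [← hi, numEnds, add_zero]

/-- Here α pairs are matched inside A, β pairs outside A, and i pairs across; the induction removes
them one at a time in this order. -/
theorem exists_isPerfectOn (A : Finset (Fin n)) (i α β : ℕ) (S : Finset (Fin n))
    (h₁ : (S ∩ A).card = i + 2 * α) (h₂ : (S \ A).card = i + 2 * β) :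
    ∃ M, IsPerfectOn S M ∧ numEnds A 1 M = i := by
  have hinter : ∀ (S : Finset (Fin n)) (u v : Fin n), (S.erase u).erase v ∩ A =
      ((S ∩ A).erase u).erase v := fun S u v => by
    ext x; simp only [Finset.mem_inter, Finset.mem_erase]; tauto
  have hdiff : ∀ (S : Finset (Fin n)) (u v : Fin n), (S.erase u).erase v \ A =
      ((S \ A).erase u).erase v := fun S u v => by
    ext x; simp only [Finset.mem_sdiff, Finset.mem_erase]; tauto
  induction α generalizing S with
  | succ α ih =>
    obtain ⟨u, hu, v, hv, huv⟩ := Finset.one_lt_card.1 (show 1 < (S ∩ A).card by omega)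
    rw [Finset.mem_inter] at hu hv
    obtain ⟨M, hM, h⟩ := exists_isPerfectOn_of_pair (A := A) huv hu.1 hv.1 (i := i) (ih _
      (by rw [hinter, Finset.card_erase_of_mem (by simp [hv, huv.symm]),
        Finset.card_erase_of_mem (by simp [hu])]; omega)
      (by rw [hdiff, Finset.erase_eq_of_notMem (by simp [hv]),
        Finset.erase_eq_of_notMem (by simp [hu]), h₂]))
    exact ⟨M, hM, by simpa [endsIn_mkEdge, hu, hv] using h⟩
  | zero =>
    induction β generalizing S with
    | succ β ih =>
      obtain ⟨u, hu, v, hv, huv⟩ := Finset.one_lt_card.1 (show 1 < (S \ A).card by omega)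
      rw [Finset.mem_sdiff] at hu hv
      obtain ⟨M, hM, h⟩ := exists_isPerfectOn_of_pair (A := A) huv hu.1 hv.1 (i := i) (ih _
        (by rw [hinter, Finset.erase_eq_of_notMem (by simp [hv]),
          Finset.erase_eq_of_notMem (by simp [hu]), h₁])
        (by rw [hdiff, Finset.card_erase_of_mem (by simp [hv, huv.symm]),
          Finset.card_erase_of_mem (by simp [hu])]; omega))
      exact ⟨M, hM, by simpa [endsIn_mkEdge, hu, hv] using h⟩
    | zero =>
      induction i generalizing S with
      | succ i ih =>
        obtain ⟨u, hu⟩ := Finset.card_pos.1 (show 0 < (S ∩ A).card by omega)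
        obtain ⟨v, hv⟩ := Finset.card_pos.1 (show 0 < (S \ A).card by omega)
        rw [Finset.mem_inter] at hu
        rw [Finset.mem_sdiff] at hv
        have huv : u ≠ v := fun e => hv.2 (e ▸ hu.2)
        obtain ⟨M, hM, h⟩ := exists_isPerfectOn_of_pair (A := A) huv hu.1 hv.1 (i := i) (ih _
          (by rw [hinter, Finset.erase_eq_of_notMem (by simp [hv]),
            Finset.card_erase_of_mem (by simp [hu])]; omega)
          (by rw [hdiff, Finset.card_erase_of_mem (by simp [hv, huv.symm]),
            Finset.erase_eq_of_notMem (by simp [hu])]; omega))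
        exact ⟨M, hM, by simpa [endsIn_mkEdge, hu, hv] using h⟩
      | zero =>
        have hS : S = ∅ := by
          rw [← Finset.sdiff_union_inter S A, Finset.card_eq_zero.1 h₁, Finset.card_eq_zero.1 h₂,
            Finset.empty_union]
        subst hS
        exact ⟨∅, ⟨isMatching_of (by simp), by simp⟩, by simp [numEnds]⟩

theorem exists_isMatching_card (n ℓ : ℕ) (h : 2 * ℓ ≤ n) :
    ∃ M : Finset (KEdge n), IsMatching M ∧ M.card = ℓ := by
  obtain ⟨S, -, hS⟩ := Finset.exists_subset_card_eq (s := (Finset.univ : Finset (Fin n)))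
    (n := 2 * ℓ) (by simpa using h)
  obtain ⟨M, hM, -⟩ := exists_isPerfectOn ∅ 0 0 ℓ S (by simp) (by simp [hS])
  exact ⟨M, hM.isMatching, by have := hM.card_eq; omega⟩

end Edges

end SymExt

namespace SymExt

open Equiv Polynomial

/-! ### Counting perfect matchings by the number of cut edges, and signed weights. -/

section Counting

variable {n : ℕ}

theorem swap_apply_mem_iff {A : Finset (Fin n)} {x y : Fin n} (h : x ∈ A ↔ y ∈ A) (z : Fin n) :
    swap x y z ∈ A ↔ z ∈ A := by
  rw [swap_apply_def]
  split_ifs with h1 h2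
  · rw [h1, h]
  · rw [h2, h]
  · rfl

theorem exists_mkEdge_of_endsIn_eq {A : Finset (Fin n)} {e e' : KEdge n}
    (h : endsIn A e = endsIn A e') : ∃ (u v u' v' : Fin n) (huv : u ≠ v) (huv' : u' ≠ v'),
      e = mkEdge u v huv ∧ e' = mkEdge u' v' huv' ∧ (u ∈ A ↔ u' ∈ A) ∧ (v ∈ A ↔ v' ∈ A) := by
  obtain ⟨u, v, huv, rfl⟩ := exists_eq_mkEdge e
  obtain ⟨u', v', huv', rfl⟩ := exists_eq_mkEdge e'
  rw [endsIn_mkEdge, endsIn_mkEdge] at h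
  by_cases huA : u ∈ A ↔ u' ∈ A
  · refine ⟨u, v, u', v', huv, huv', rfl, rfl, huA, ?_⟩
    by_cases h1 : u ∈ A <;> by_cases h2 : v ∈ A <;> by_cases h3 : v' ∈ A <;> simp_all
  · refine ⟨u, v, v', u', huv, huv'.symm, rfl, mkEdge_comm _, ?_, ?_⟩ <;>
    by_cases h1 : u ∈ A <;> by_cases h2 : v ∈ A <;> by_cases h3 : v' ∈ A <;>
      by_cases h4 : u' ∈ A <;> simp_all

theorem IsPerfectOn.mapEdges {S : Finset (Fin n)} {M : Finset (KEdge n)} (hM : IsPerfectOn S M)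
    {π : Perm (Fin n)} (h : ∀ x, π x ∈ S ↔ x ∈ S) : IsPerfectOn S (mapEdges π M) := by
  refine ⟨hM.isMatching.mapEdges π, fun v => ?_⟩
  obtain ⟨v, rfl⟩ := π.surjective v
  rw [h, hM.mem_iff]
  constructor
  · rintro ⟨e, he, hv⟩
    exact ⟨_, mem_mapEdges.2 he, (mem_edgePerm π e v).2 hv⟩
  · rintro ⟨e, he, hv⟩
    obtain ⟨f, hf, rfl⟩ := exists_of_mem_mapEdges he
    exact ⟨f, hf, (mem_edgePerm π f v).1 hv⟩

theorem numEnds_mapEdges {A : Finset (Fin n)} {π : Perm (Fin n)} (h : ∀ x, π x ∈ A ↔ x ∈ A)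
    (t : ℕ) (M : Finset (KEdge n)) : numEnds A t (mapEdges π M) = numEnds A t M := by
  rw [numEnds, mapEdges, Finset.filter_map, Finset.card_map, numEnds]
  congr 1
  ext e
  simp [endsIn_edgePerm h]

open Classical in
/-- The perfect matchings on `S` containing `τ` with exactly `i` edges leaving `A`. -/
noncomputable def perfectExt (A S : Finset (Fin n)) (i : ℕ) (τ : Finset (KEdge n)) :
    Finset (Finset (KEdge n)) :=
  Finset.univ.filter fun M => IsPerfectOn S M ∧ numEnds A 1 M = i ∧ τ ⊆ M

theorem mem_perfectExt {A S : Finset (Fin n)} {i : ℕ} {τ M : Finset (KEdge n)} :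
    M ∈ perfectExt A S i τ ↔ IsPerfectOn S M ∧ numEnds A 1 M = i ∧ τ ⊆ M := by
  simp [perfectExt]

/-- A node permutation carrying e to e', preserving A and S and fixing the edges of τ, maps the
first family injectively into the second. -/
theorem card_perfectExt_insert_le {A S : Finset (Fin n)} (i : ℕ)
    {τ : Finset (KEdge n)} {e e' : KEdge n} (he : ∀ v ∈ (e : Sym2 (Fin n)), v ∈ S)
    (he' : ∀ v ∈ (e' : Sym2 (Fin n)), v ∈ S) (hee' : endsIn A e = endsIn A e')
    (hτ : ∀ f ∈ τ, ∀ v ∈ (f : Sym2 (Fin n)), v ∉ (e : Sym2 (Fin n)) ∧ v ∉ (e' : Sym2 (Fin n))) :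
    (perfectExt A S i (insert e τ)).card ≤ (perfectExt A S i (insert e' τ)).card := by
  obtain ⟨u, v, u', v', huv, huv', rfl, rfl, hu, hv⟩ := exists_mkEdge_of_endsIn_eq hee'
  simp only [mem_mkEdge, not_or] at hτ he he'
  obtain ⟨w, hw, hπu, hπv⟩ := exists_perm_pair huv huv'
  set π := swap w v' * swap u u' with hπ
  have hpres : ∀ T : Finset (Fin n), (u ∈ T ↔ u' ∈ T) → (v ∈ T ↔ v' ∈ T) → ∀ x, π x ∈ T ↔ x ∈ T := by
    intro T h1 h2 x
    have h3 : w ∈ T ↔ v' ∈ T := by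
      have h4 : w = swap u u' v := by
        rw [hπ, Perm.mul_apply] at hπv
        exact ((swap w v').injective (hπv.trans (swap_apply_left w v').symm)).symm
      rw [h4, swap_apply_mem_iff h1, h2]
    rw [hπ, Perm.mul_apply, swap_apply_mem_iff h3, swap_apply_mem_iff h1]
  have hA := hpres A hu hv
  have hS := hpres S (by simp [he u, he' u']) (by simp [he v, he' v'])
  refine Finset.card_le_card_of_injOn (mapEdges π) (fun M hM => ?_)
    (Finset.map_injective _).injOn
  obtain ⟨hM, hi, hsub⟩ := mem_perfectExt.1 hM
  refine mem_perfectExt.2 ⟨hM.mapEdges hS, by rw [numEnds_mapEdges hA, hi], fun f hf => ?_⟩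
  rcases Finset.mem_insert.1 hf with rfl | hf
  · have : mkEdge u' v' huv' = edgePerm π (mkEdge u v huv) := by
      simp only [edgePerm_mkEdge, hπu, hπv]
    rw [this, mem_mapEdges]
    exact hsub (Finset.mem_insert_self _ _)
  · have hfix : edgePerm π f = f := edgePerm_eq_self fun x hx => by
      obtain ⟨⟨h1, h2⟩, h3, h4⟩ := hτ f hf x hx
      have hxw : x ≠ w := by rcases hw with rfl | rfl | rfl | rfl <;> assumption
      rw [hπ, Perm.mul_apply, swap_apply_of_ne_of_ne h1 h3, swap_apply_of_ne_of_ne hxw h4]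
    rw [← hfix, mem_mapEdges]
    exact hsub (Finset.mem_insert_of_mem hf)

open Classical in
/-- The edges within `S` of the same type as `e` (relative to `A`) that avoid the nodes of `τ`. -/
noncomputable def similarEdges (A S : Finset (Fin n)) (τ : Finset (KEdge n)) (e : KEdge n) :
    Finset (KEdge n) :=
  Finset.univ.filter fun e' => (∀ v ∈ (e' : Sym2 (Fin n)), v ∈ S) ∧ endsIn A e' = endsIn A e ∧
    ∀ f ∈ τ, ∀ v ∈ (f : Sym2 (Fin n)), v ∉ (e' : Sym2 (Fin n))

theorem mem_similarEdges {A S : Finset (Fin n)} {τ : Finset (KEdge n)} {e e' : KEdge n} :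
    e' ∈ similarEdges A S τ e ↔ (∀ v ∈ (e' : Sym2 (Fin n)), v ∈ S) ∧ endsIn A e' = endsIn A e ∧
      ∀ f ∈ τ, ∀ v ∈ (f : Sym2 (Fin n)), v ∉ (e' : Sym2 (Fin n)) := by
  simp [similarEdges]

theorem card_similarEdges_mem {A S : Finset (Fin n)} {τ M : Finset (KEdge n)} (e : KEdge n)
    (hM : IsPerfectOn S M) (hτ : τ ⊆ M) :
    ((similarEdges A S τ e).filter (· ∈ M)).card + numEnds A (endsIn A e) τ =
      numEnds A (endsIn A e) M := by
  have h1 : (similarEdges A S τ e).filter (· ∈ M) =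
      (M \ τ).filter fun e' => endsIn A e' = endsIn A e := by
    ext f
    simp only [Finset.mem_filter, mem_similarEdges, Finset.mem_sdiff]
    constructor
    · rintro ⟨⟨-, h2, h3⟩, hf⟩
      refine ⟨⟨hf, fun hfτ => ?_⟩, h2⟩
      obtain ⟨u, v, huv, rfl⟩ := exists_eq_mkEdge f
      have := (mem_mkEdge huv).2 (Or.inl rfl : u = u ∨ u = v)
      exact h3 _ hfτ u this this
    · rintro ⟨⟨hf, hfτ⟩, h2⟩
      exact ⟨⟨fun v hv => (hM.mem_iff v).2 ⟨f, hf, hv⟩, h2, fun g hg v hv hv' =>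
        hfτ (hM.isMatching.eq_of_mem (hτ hg) hf hv hv' ▸ hg)⟩, hf⟩
  rw [h1, numEnds, numEnds, ← Finset.card_union_of_disjoint, ← Finset.filter_union,
    Finset.sdiff_union_of_subset hτ]
  exact Finset.disjoint_filter_filter Finset.sdiff_disjoint

theorem sum_card_perfectExt_insert (A S : Finset (Fin n)) (i : ℕ) (τ : Finset (KEdge n))
    (C : Finset (KEdge n)) : ∑ e ∈ C, (perfectExt A S i (insert e τ)).card =
      ∑ M ∈ perfectExt A S i τ, (C.filter (· ∈ M)).card := by
  have h1 : ∀ e, perfectExt A S i (insert e τ) = (perfectExt A S i τ).filter (e ∈ ·) := by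
    intro e
    ext M
    simp only [Finset.mem_filter, mem_perfectExt, Finset.insert_subset_iff]
    tauto
  simp only [h1, Finset.card_filter]
  exact Finset.sum_comm

/-- The number of edges with `t` nodes in `A`, as a polynomial in the number of edges
leaving `A`, for perfect matchings on a set of `4 k + 2` nodes half of which are in `A`. -/
noncomputable def typePoly (k t : ℕ) : ℝ[X] :=
  if t = 1 then X else C ((2 * k + 1 : ℝ) / 2) - C (1 / 2) * X

theorem natDegree_typePoly_le (k t : ℕ) : (typePoly k t).natDegree ≤ 1 := by
  unfold typePoly
  split_ifs
  · exact natDegree_X_le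
  · refine (natDegree_sub_le _ _).trans (max_le (by simp) ?_)
    exact (natDegree_C_mul_le _ _).trans natDegree_X_le

theorem IsPerfectOn.numEnds_eq {A S : Finset (Fin n)} {k : ℕ} (hAS : A ⊆ S)
    (hA : A.card = 2 * k + 1) (hS : S.card = 4 * k + 2) {M : Finset (KEdge n)}
    (hM : IsPerfectOn S M) {t : ℕ} (ht : t ≤ 2) :
    (numEnds A t M : ℝ) = (typePoly k t).eval (numEnds A 1 M : ℝ) := by
  have h1 := hM.sum_endsIn hAS
  rw [sum_endsIn_eq, hA] at h1
  have h2 := hM.card_eq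
  rw [card_eq_numEnds A, hS] at h2
  have h1' : (numEnds A 1 M : ℝ) + 2 * numEnds A 2 M = 2 * k + 1 := by exact_mod_cast h1
  have h2' : (numEnds A 0 M : ℝ) = numEnds A 2 M := by
    have : numEnds A 0 M = numEnds A 2 M := by omega
    exact_mod_cast this
  interval_cases t
  · simp [typePoly]; linarith
  · simp [typePoly]
  · simp [typePoly]; linarith

/-- The fraction of matchings containing τ is a product with one linear factor per edge. At i = 0
the factor of the first cut edge of τ vanishes, while an uncut edge contributes a multiple of
(2k+1)/2 minus a number that is at most k when |τ| ≤ k. The clause on cut edges is what carries the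
sign through the induction. -/
theorem exists_perfectExt_poly {A S : Finset (Fin n)} {k : ℕ} (hAS : A ⊆ S)
    (hA : A.card = 2 * k + 1) (hS : S.card = 4 * k + 2) (τ : Finset (KEdge n))
    (hτ : IsMatching τ) (hτS : ∀ e ∈ τ, ∀ v ∈ (e : Sym2 (Fin n)), v ∈ S) :
    ∃ q : ℝ[X], q.natDegree ≤ τ.card ∧
      (∀ i : ℕ, ((perfectExt A S i τ).card : ℝ) = (perfectExt A S i ∅).card * q.eval (i : ℝ)) ∧
      (τ.card ≤ k → 0 ≤ q.eval 0) ∧ (0 < numEnds A 1 τ → q.eval 0 = 0) := by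
  induction τ using Finset.induction_on with
  | empty => exact ⟨1, by simp, by simp, by simp, by simp [numEnds]⟩
  | insert e τ heτ ih =>
    obtain ⟨q, hdeg, hq, hpos, hzero⟩ := ih (hτ.mono (Finset.subset_insert _ _))
      fun f hf => hτS f (Finset.mem_insert_of_mem hf)
    set t := endsIn A e with ht
    set K := (similarEdges A S τ e).card with hK
    have hdisj : ∀ f ∈ τ, ∀ v ∈ (f : Sym2 (Fin n)), v ∉ (e : Sym2 (Fin n)) := fun f hf v hv hve =>
      heτ (hτ.eq_of_mem (Finset.mem_insert_of_mem hf) (Finset.mem_insert_self _ _) hv hve ▸ hf)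
    have heS := hτS e (Finset.mem_insert_self _ _)
    have hmem : e ∈ similarEdges A S τ e := mem_similarEdges.2 ⟨heS, rfl, hdisj⟩
    have hK0 : (0 : ℝ) < K := by exact_mod_cast Finset.card_pos.2 ⟨e, hmem⟩
    -- Double counting of pairs (e', M), where e' is similar to e and M contains τ and e'. By
    -- symmetry all e' occur equally often, and each M contains as many such e' as it has edges of
    -- this type outside τ.
    have hstep : ∀ i : ℕ, (K : ℝ) * (perfectExt A S i (insert e τ)).card =
        (perfectExt A S i τ).card * ((typePoly k t).eval (i : ℝ) - numEnds A t τ) := by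
      intro i
      have h1 := sum_card_perfectExt_insert A S i τ (similarEdges A S τ e)
      have h2 : ∑ e' ∈ similarEdges A S τ e, (perfectExt A S i (insert e' τ)).card =
          K * (perfectExt A S i (insert e τ)).card := by
        rw [hK, ← smul_eq_mul, ← Finset.sum_const]
        refine Finset.sum_congr rfl fun e' he' => ?_
        obtain ⟨h3, h4, h5⟩ := mem_similarEdges.1 he'
        exact le_antisymm
          (card_perfectExt_insert_le i h3 heS h4 fun f hf v hv => ⟨h5 f hf v hv, hdisj f hf v hv⟩)
          (card_perfectExt_insert_le i heS h3 h4.symm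
            fun f hf v hv => ⟨hdisj f hf v hv, h5 f hf v hv⟩)
      rw [h2] at h1
      have h3 : ((K * (perfectExt A S i (insert e τ)).card : ℕ) : ℝ) =
          ∑ M ∈ perfectExt A S i τ, ((typePoly k t).eval (i : ℝ) - numEnds A t τ) := by
        rw [h1, Nat.cast_sum]
        refine Finset.sum_congr rfl fun M hM => ?_
        obtain ⟨hM1, hM2, hM3⟩ := mem_perfectExt.1 hM
        rw [← hM2, ← hM1.numEnds_eq hAS hA hS (endsIn_le_two A e),
          ← card_similarEdges_mem e hM1 hM3]
        push_cast
        ring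
      rw [Finset.sum_const, nsmul_eq_mul] at h3
      rw [← h3]
      push_cast
      ring
    refine ⟨C (K : ℝ)⁻¹ * (q * (typePoly k t - C (numEnds A t τ : ℝ))), ?_, fun i => ?_, fun h => ?_,
      fun h => ?_⟩
    · rw [Finset.card_insert_of_notMem heτ]
      refine (natDegree_C_mul_le _ _).trans (natDegree_mul_le.trans (add_le_add hdeg ?_))
      exact (natDegree_sub_le _ _).trans (max_le (natDegree_typePoly_le k t) (by simp))
    · have h1 := hstep i
      rw [hq] at h1
      simp only [eval_mul, eval_C, eval_sub]
      field_simp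
      linarith
    · rw [Finset.card_insert_of_notMem heτ] at h
      have h1 := hpos (by omega)
      simp only [eval_mul, eval_C, eval_sub]
      by_cases h0 : 0 < numEnds A 1 τ
      · rw [hzero h0]; simp
      refine mul_nonneg (by positivity) (mul_nonneg h1 ?_)
      unfold typePoly
      split_ifs with ht1
      · rw [ht1]
        have : numEnds A 1 τ = 0 := by omega
        simp [this]
      · have h2 : numEnds A t τ ≤ k := (Finset.card_filter_le _ _).trans (by omega)
        have h3 : (numEnds A t τ : ℝ) ≤ k := by exact_mod_cast h2
        simp
        linarith
    · simp only [eval_mul, eval_C, eval_sub]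
      by_cases h0 : 0 < numEnds A 1 τ
      · rw [hzero h0]; simp
      · have h1 : numEnds A 1 τ = 0 := by omega
        have ht1 : t = 1 := by
          by_contra ht1
          rw [numEnds, Finset.filter_insert, if_neg ht1] at h
          exact h0 h
        rw [ht1, h1, typePoly, if_pos rfl]
        simp

/-- The weights are the Lagrange basis polynomials for the nodes 1, 3, …, 2k+1, evaluated at 0. -/
theorem exists_interpolation_weights (k : ℕ) : ∃ w : ℕ → ℝ, ∀ q : ℝ[X], q.natDegree ≤ k →
    ∑ j ∈ Finset.range (k + 1), w j * q.eval ((2 * j + 1 : ℕ) : ℝ) = q.eval 0 := by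
  refine ⟨fun j => (Lagrange.basis (Finset.range (k + 1))
    (fun j : ℕ => ((2 * j + 1 : ℕ) : ℝ)) j).eval 0, fun q hq => ?_⟩
  have hinj : Set.InjOn (fun j : ℕ => ((2 * j + 1 : ℕ) : ℝ)) (Finset.range (k + 1)) := by
    intro i _ j _ h
    have : 2 * i + 1 = 2 * j + 1 := Nat.cast_injective h
    omega
  have hdeg : q.degree < (Finset.range (k + 1)).card := by
    rw [Finset.card_range]
    exact (degree_le_of_natDegree_le hq).trans_lt (by exact_mod_cast Nat.lt_succ_self k)
  conv_rhs => rw [Lagrange.eq_interpolate hinj hdeg, Lagrange.interpolate_apply, eval_finsetSum]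
  refine Finset.sum_congr rfl fun j _ => ?_
  rw [eval_mul, eval_C, mul_comm]

open Classical in
/-- The perfect matchings on `S`. -/
noncomputable def perfectMatchings (S : Finset (Fin n)) : Finset (Finset (KEdge n)) :=
  Finset.univ.filter (IsPerfectOn S)

theorem mem_perfectMatchings {S : Finset (Fin n)} {M : Finset (KEdge n)} :
    M ∈ perfectMatchings S ↔ IsPerfectOn S M := by
  simp [perfectMatchings]

/-- There are signed weights on the perfect matchings on `S` with total weight one that look
nonnegative on all partial matchings with at most `k` edges and such that the weighted number of
edges leaving `A` vanishes. -/
theorem exists_signed_weights {A S : Finset (Fin n)} {k : ℕ} (hk : 1 ≤ k) (hAS : A ⊆ S)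
    (hA : A.card = 2 * k + 1) (hS : S.card = 4 * k + 2) :
    ∃ c : Finset (KEdge n) → ℝ,
      (∀ τ : Finset (KEdge n), IsMatching τ → (∀ e ∈ τ, ∀ v ∈ (e : Sym2 (Fin n)), v ∈ S) →
        τ.card ≤ k → 0 ≤ ∑ M ∈ (perfectMatchings S).filter (τ ⊆ ·), c M) ∧
      ∑ M ∈ perfectMatchings S, c M = 1 ∧
      ∑ M ∈ perfectMatchings S, c M * numEnds A 1 M = 0 := by
  obtain ⟨w, hw⟩ := exists_interpolation_weights k
  -- Since |A| is odd, M has 2j+1 edges leaving A for some j ≤ k, and `g M` is this j.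
  set g : Finset (KEdge n) → ℕ := fun M => (numEnds A 1 M - 1) / 2 with hg
  have hodd : ∀ M ∈ perfectMatchings S, numEnds A 1 M = 2 * g M + 1 ∧ g M ∈ Finset.range (k + 1) := by
    intro M hM
    have h1 := (mem_perfectMatchings.1 hM).sum_endsIn hAS
    rw [sum_endsIn_eq, hA] at h1
    rw [Finset.mem_range]
    simp only [hg]
    omega
  have hpos : ∀ j ∈ Finset.range (k + 1), (0 : ℝ) < (perfectExt A S (2 * j + 1) ∅).card := by
    intro j hj
    rw [Finset.mem_range] at hj
    have h1 : (S ∩ A).card = 2 * k + 1 := by rw [Finset.inter_eq_right.2 hAS, hA]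
    have h2 : (S \ A).card = 2 * k + 1 := by
      rw [Finset.card_sdiff_of_subset hAS, hA, hS]; omega
    obtain ⟨M, hM, hi⟩ := exists_isPerfectOn A (2 * j + 1) (k - j) (k - j) S (by omega) (by omega)
    exact_mod_cast Finset.card_pos.2 ⟨M, mem_perfectExt.2 ⟨hM, hi, by simp⟩⟩
  have hsum : ∀ (τ : Finset (KEdge n)) (F : ℕ → ℝ),
      ∑ M ∈ (perfectMatchings S).filter (τ ⊆ ·),
        w (g M) / (perfectExt A S (2 * g M + 1) ∅).card * F (2 * g M + 1) =
      ∑ j ∈ Finset.range (k + 1), w j / (perfectExt A S (2 * j + 1) ∅).card * F (2 * j + 1) *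
        (perfectExt A S (2 * j + 1) τ).card := by
    intro τ F
    rw [← Finset.sum_fiberwise_of_maps_to (g := g) (t := Finset.range (k + 1))
      (fun M hM => (hodd M (Finset.mem_filter.1 hM).1).2)]
    refine Finset.sum_congr rfl fun j _ => ?_
    have h1 : ((perfectMatchings S).filter (τ ⊆ ·)).filter (fun M => g M = j) =
        perfectExt A S (2 * j + 1) τ := by
      ext M
      simp only [Finset.mem_filter, mem_perfectExt]
      constructor
      · rintro ⟨⟨h2, h3⟩, h4⟩
        exact ⟨mem_perfectMatchings.1 h2, by rw [(hodd M h2).1, h4], h3⟩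
      · rintro ⟨h2, h3, h4⟩
        exact ⟨⟨mem_perfectMatchings.2 h2, h4⟩, by simp only [hg, h3]; omega⟩
    rw [h1]
    have h2 : ∀ M ∈ perfectExt A S (2 * j + 1) τ,
        w (g M) / ((perfectExt A S (2 * g M + 1) ∅).card : ℝ) * F (2 * g M + 1) =
          w j / ((perfectExt A S (2 * j + 1) ∅).card : ℝ) * F (2 * j + 1) := fun M hM => by
      rw [← h1] at hM
      rw [(Finset.mem_filter.1 hM).2]
    rw [Finset.sum_congr rfl h2, Finset.sum_const, nsmul_eq_mul, mul_comm]
  -- Each interpolation weight is spread evenly over its class of matchings. The three claims are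
  -- extrapolation to 0 of the containment polynomial of τ, of the constant 1, and of X; the last
  -- one needs k ≥ 1.
  refine ⟨fun M => w (g M) / (perfectExt A S (2 * g M + 1) ∅).card, fun τ hτ hτS hτk => ?_, ?_, ?_⟩
  · obtain ⟨q, hdeg, hq, hq0, -⟩ := exists_perfectExt_poly hAS hA hS τ hτ hτS
    have h1 := hsum τ fun _ => 1
    simp only [mul_one] at h1
    rw [h1]
    have h2 := hw q (hdeg.trans hτk)
    refine (hq0 hτk).trans_eq (h2.symm.trans (Finset.sum_congr rfl fun j hj => ?_))
    have := (hpos j hj).ne'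
    rw [hq]
    field_simp
  · have h1 := hsum ∅ fun _ => 1
    simp only [mul_one, Finset.empty_subset, Finset.filter_true] at h1
    rw [h1]
    have h2 := hw 1 (by simp)
    rw [eval_one] at h2
    rw [← h2]
    refine Finset.sum_congr rfl fun j hj => ?_
    have := (hpos j hj).ne'
    rw [eval_one]
    field_simp
  · have h1 := hsum ∅ fun i => (i : ℝ)
    simp only [Finset.empty_subset, Finset.filter_true] at h1
    have h2 := hw X (natDegree_X_le.trans hk)
    rw [eval_X] at h2
    have h3 : ∑ M ∈ perfectMatchings S,
        w (g M) / ((perfectExt A S (2 * g M + 1) ∅).card : ℝ) * (numEnds A 1 M : ℝ) =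
        ∑ M ∈ perfectMatchings S,
          w (g M) / ((perfectExt A S (2 * g M + 1) ∅).card : ℝ) * ((2 * g M + 1 : ℕ) : ℝ) :=
      Finset.sum_congr rfl fun M hM => by rw [← (hodd M hM).1]
    rw [h3, h1, ← h2]
    refine Finset.sum_congr rfl fun j hj => ?_
    have := (hpos j hj).ne'
    rw [eval_X]
    field_simp

end Counting

end SymExt

namespace SymExt

open Equiv

/-! ### Functions on matchings that are invariant under even permutations fixing a small set. -/

section Invariance

variable {n : ℕ}

/-- The edge `e` has a node in `W`. -/
def Touches (W : Finset (Fin n)) (e : KEdge n) : Prop := ∃ v ∈ W, v ∈ (e : Sym2 (Fin n))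

open Classical in
/-- The edges of `M` with a node in `W`. -/
noncomputable def touching (W : Finset (Fin n)) (M : Finset (KEdge n)) : Finset (KEdge n) :=
  M.filter (Touches W)

theorem mem_touching {W : Finset (Fin n)} {M : Finset (KEdge n)} {e : KEdge n} :
    e ∈ touching W M ↔ e ∈ M ∧ Touches W e := by
  simp [touching]

theorem touching_subset (W : Finset (Fin n)) (M : Finset (KEdge n)) : touching W M ⊆ M :=
  fun _ he => (mem_touching.1 he).1

theorem IsMatching.card_touching_le {M : Finset (KEdge n)} (hM : IsMatching M)
    (W : Finset (Fin n)) : (touching W M).card ≤ W.card := by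
  have h : ∀ e ∈ touching W M, ∃ v, v ∈ W ∧ v ∈ (e : Sym2 (Fin n)) := fun e he =>
    (mem_touching.1 he).2
  choose f hfW hf using h
  rw [← Finset.card_attach]
  refine Finset.card_le_card_of_injOn (fun e => f e.1 e.2) (fun e _ => hfW _ _) ?_
  intro e _ e' _ heq
  have h1 := hf e.1 e.2
  simp only at heq
  rw [heq] at h1
  exact Subtype.ext (hM.eq_of_mem (touching_subset W M e.2) (touching_subset W M e'.2) h1
    (hf e'.1 e'.2))

variable {W : Finset (Fin n)} {a : Finset (KEdge n) → ℝ}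

/-- A matching with more than |W| edges has an edge {p,q} avoiding W. The transposition (p q) fixes
the matching, so it corrects the parity of (x y) at no cost. -/
theorem apply_mapEdges_swap (ha : ∀ p q r s : Fin n, p ∉ W → q ∉ W → r ∉ W → s ∉ W → p ≠ q →
      r ≠ s → ∀ M, a (mapEdges (swap p q * swap r s) M) = a M)
    {x y : Fin n} (hx : x ∉ W) (hy : y ∉ W) {M : Finset (KEdge n)} (hM : IsMatching M)
    (hcard : W.card < M.card) : a (mapEdges (swap x y) M) = a M := by
  by_cases hxy : x = y
  · rw [hxy, swap_self]
    exact congrArg a (mapEdges_one M)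
  obtain ⟨e, he, heW⟩ : ∃ e ∈ M, e ∉ touching W M := by
    by_contra! h
    have h1 := Finset.card_le_card h
    have h2 := hM.card_touching_le W
    omega
  obtain ⟨p, q, hpq, rfl⟩ := exists_eq_mkEdge e
  have hnot : ∀ v ∈ (mkEdge p q hpq : Sym2 (Fin n)), v ∉ W := fun v hv hvW =>
    heW (mem_touching.2 ⟨he, v, hvW, hv⟩)
  have hp : p ∈ (mkEdge p q hpq : Sym2 (Fin n)) := (mem_mkEdge hpq).2 (Or.inl rfl)
  have hq : q ∈ (mkEdge p q hpq : Sym2 (Fin n)) := (mem_mkEdge hpq).2 (Or.inr rfl)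
  have hfix : mapEdges (swap p q) M = M := by
    refine Finset.eq_of_subset_of_card_le (fun f hf => ?_) (card_mapEdges _ _).ge
    obtain ⟨f, hf', rfl⟩ := exists_of_mem_mapEdges hf
    by_cases hfe : f = mkEdge p q hpq
    · rw [hfe, edgePerm_mkEdge]
      simp only [swap_apply_left, swap_apply_right]
      rwa [mkEdge_comm]
    · rwa [edgePerm_eq_self fun v hv => swap_apply_of_ne_of_ne ?_ ?_]
      · rintro rfl
        exact hfe (hM.eq_of_mem hf' he hv hp)
      · rintro rfl
        exact hfe (hM.eq_of_mem hf' he hv hq)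
  rw [← ha x y p q hx hy (hnot p hp) (hnot q hq) hxy hpq M, mapEdges_mul, hfix]

/-- An edge of M missing from N can be moved onto an edge of N missing from M by two transpositions
outside W. These keep the common edges fixed, so the difference shrinks until M becomes N. -/
theorem apply_eq_of_touching_eq (ha : ∀ p q r s : Fin n, p ∉ W → q ∉ W → r ∉ W → s ∉ W → p ≠ q →
      r ≠ s → ∀ M, a (mapEdges (swap p q * swap r s) M) = a M)
    {M N : Finset (KEdge n)} (hM : IsMatching M) (hN : IsMatching N) (hMN : M.card = N.card)
    (hcard : W.card < M.card) (hW : touching W M = touching W N) : a M = a N := by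
  induction hm : (M \ N).card using Nat.strong_induction_on generalizing M with
  | _ m ih =>
  subst hm
  by_cases hsub : M ⊆ N
  · rw [Finset.eq_of_subset_of_card_le hsub hMN.ge]
  obtain ⟨f, hf, hfN⟩ := Finset.not_subset.1 hsub
  obtain ⟨e, he, heM⟩ : ∃ e ∈ N, e ∉ M := by
    by_contra! h
    exact hsub (Finset.eq_of_subset_of_card_le h hMN.le).ge
  have hfW : ∀ v ∈ (f : Sym2 (Fin n)), v ∉ W := fun v hv hvW => by
    have : f ∈ touching W M := mem_touching.2 ⟨hf, v, hvW, hv⟩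
    rw [hW] at this
    exact hfN (touching_subset _ _ this)
  have heW : ∀ v ∈ (e : Sym2 (Fin n)), v ∉ W := fun v hv hvW => by
    have : e ∈ touching W N := mem_touching.2 ⟨he, v, hvW, hv⟩
    rw [← hW] at this
    exact heM (touching_subset _ _ this)
  have hcommon : ∀ g ∈ M, g ∈ N → ∀ v ∈ (g : Sym2 (Fin n)), v ∉ (f : Sym2 (Fin n)) ∧
      v ∉ (e : Sym2 (Fin n)) := fun g hgM hgN v hv =>
    ⟨fun hvf => hfN (hM.eq_of_mem hgM hf hv hvf ▸ hgN),
      fun hve => heM (hN.eq_of_mem hgN he hv hve ▸ hgM)⟩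
  obtain ⟨u, v, huv, rfl⟩ := exists_eq_mkEdge f
  obtain ⟨u', v', huv', rfl⟩ := exists_eq_mkEdge e
  simp only [mem_mkEdge, forall_eq_or_imp, forall_eq, not_or] at hfW heW hcommon
  obtain ⟨w, hw, hπu, hπv⟩ := exists_perm_pair huv huv'
  have hwW : w ∉ W := by
    rcases hw with rfl | rfl | rfl | rfl
    exacts [hfW.1, hfW.2, heW.1, heW.2]
  set π := swap w v' * swap u u' with hπ
  have hfix : ∀ x : Fin n, x ≠ u → x ≠ v → x ≠ u' → x ≠ v' → π x = x := fun x h1 h2 h3 h4 => by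
    have hxw : x ≠ w := by rcases hw with rfl | rfl | rfl | rfl <;> assumption
    rw [hπ, Perm.mul_apply, swap_apply_of_ne_of_ne h1 h3, swap_apply_of_ne_of_ne hxw h4]
  have hπW : ∀ x ∈ W, π x = x := fun x hx => hfix x (fun h => hfW.1 (h ▸ hx))
    (fun h => hfW.2 (h ▸ hx)) (fun h => heW.1 (h ▸ hx)) (fun h => heW.2 (h ▸ hx))
  have hπg : ∀ g ∈ M, g ∈ N → edgePerm π g = g := fun g hgM hgN => edgePerm_eq_self fun x hx => by
    obtain ⟨⟨h1, h2⟩, h3, h4⟩ := hcommon g hgM hgN x hx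
    exact hfix x h1 h2 h3 h4
  have haπ : a (mapEdges π M) = a M := by
    rw [hπ, mapEdges_mul, apply_mapEdges_swap ha hwW heW.2 (hM.mapEdges _)
      (by rwa [card_mapEdges]), apply_mapEdges_swap ha hfW.1 heW.1 hM hcard]
  have hπe : edgePerm π (mkEdge u v huv) = mkEdge u' v' huv' := by
    simp only [edgePerm_mkEdge, hπu, hπv]
  rw [← haπ]
  refine ih _ ?_ (hM.mapEdges π) (by rw [card_mapEdges, hMN]) (by rwa [card_mapEdges]) ?_ rfl
  · have h1 := Finset.card_sdiff_add_card_inter M N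
    have h2 := Finset.card_sdiff_add_card_inter (mapEdges π M) N
    rw [card_mapEdges] at h2
    have h3 : insert (mkEdge u' v' huv') (M ∩ N) ⊆ mapEdges π M ∩ N := by
      intro g hg
      rcases Finset.mem_insert.1 hg with rfl | hg
      · refine Finset.mem_inter.2 ⟨?_, he⟩
        rw [← hπe]
        exact mem_mapEdges.2 hf
      · obtain ⟨hgM, hgN⟩ := Finset.mem_inter.1 hg
        refine Finset.mem_inter.2 ⟨?_, hgN⟩
        rw [← hπg g hgM hgN]
        exact mem_mapEdges.2 hgM
    have h4 := Finset.card_le_card h3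
    rw [Finset.card_insert_of_notMem fun h => heM (Finset.mem_inter.1 h).1] at h4
    omega
  · rw [← hW]
    ext g
    rw [mem_touching, mem_touching]
    have key : ∀ g ∈ M, Touches W g → edgePerm π g = g := fun g hg hgW => by
      have : g ∈ touching W M := mem_touching.2 ⟨hg, hgW⟩
      rw [hW] at this
      exact hπg g hg (touching_subset _ _ this)
    constructor
    · rintro ⟨hg, x, hxW, hx⟩
      obtain ⟨g, hg', rfl⟩ := exists_of_mem_mapEdges hg
      rw [← hπW x hxW, mem_edgePerm] at hx
      rw [key g hg' ⟨x, hxW, hx⟩]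
      exact ⟨hg', x, hxW, hx⟩
    · rintro ⟨hg, hgW⟩
      refine ⟨?_, hgW⟩
      rw [← key g hg hgW]
      exact mem_mapEdges.2 hg

theorem touching_union (W : Finset (Fin n)) (M N : Finset (KEdge n)) :
    touching W (M ∪ N) = touching W M ∪ touching W N := by
  classical exact Finset.filter_union _ _ _

theorem IsPerfectOn.union {S : Finset (Fin n)} {M E₀ : Finset (KEdge n)} (hM : IsPerfectOn S M)
    (hE₀ : IsMatching E₀) (hE₀S : ∀ e ∈ E₀, ∀ v ∈ (e : Sym2 (Fin n)), v ∉ S) :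
    IsMatching (M ∪ E₀) ∧ Disjoint M E₀ := by
  refine ⟨isMatching_of fun e he f hf v hve hvf => ?_, Finset.disjoint_left.2 fun e he he' => ?_⟩
  · rcases Finset.mem_union.1 he with he | he <;> rcases Finset.mem_union.1 hf with hf | hf
    · exact hM.isMatching.eq_of_mem he hf hve hvf
    · exact absurd ((hM.mem_iff v).2 ⟨e, he, hve⟩) (hE₀S f hf v hvf)
    · exact absurd ((hM.mem_iff v).2 ⟨f, hf, hvf⟩) (hE₀S e he v hve)
    · exact hE₀.eq_of_mem he hf hve hvf
  · obtain ⟨u, v, huv, rfl⟩ := exists_eq_mkEdge e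
    have hu := (mem_mkEdge huv).2 (Or.inl rfl : u = u ∨ u = v)
    exact hE₀S _ he' u hu ((hM.mem_iff u).2 ⟨_, he, hu⟩)

/-- A function on matchings that is invariant under the even permutations fixing at most `k` nodes
has nonnegative weighted sum, for weights that are nonnegative on all small partial matchings. -/
theorem sum_weights_mul_nonneg {S : Finset (Fin n)} {k : ℕ} (hS : S.card = 4 * k + 2)
    {c : Finset (KEdge n) → ℝ}
    (hc : ∀ τ : Finset (KEdge n), IsMatching τ → (∀ e ∈ τ, ∀ v ∈ (e : Sym2 (Fin n)), v ∈ S) →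
        τ.card ≤ k → 0 ≤ ∑ M ∈ (perfectMatchings S).filter (τ ⊆ ·), c M)
    {E₀ : Finset (KEdge n)} (hE₀ : IsMatching E₀)
    (hE₀S : ∀ e ∈ E₀, ∀ v ∈ (e : Sym2 (Fin n)), v ∉ S) (hWk : W.card ≤ k)
    (ha : ∀ p q r s : Fin n, p ∉ W → q ∉ W → r ∉ W → s ∉ W → p ≠ q →
      r ≠ s → ∀ M, a (mapEdges (swap p q * swap r s) M) = a M)
    (hpos : ∀ M ∈ perfectMatchings S, 0 ≤ a (M ∪ E₀)) :
    0 ≤ ∑ M ∈ perfectMatchings S, c M * a (M ∪ E₀) := by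
  classical
  have hmatch : ∀ M ∈ perfectMatchings S, IsMatching (M ∪ E₀) ∧
      (M ∪ E₀).card = 2 * k + 1 + E₀.card := fun M hM => by
    have hM' := mem_perfectMatchings.1 hM
    obtain ⟨h1, h2⟩ := hM'.union hE₀ hE₀S
    refine ⟨h1, ?_⟩
    rw [Finset.card_union_of_disjoint h2]
    have := hM'.card_eq
    omega
  rw [← Finset.sum_fiberwise_of_maps_to (g := touching W)
    (t := (perfectMatchings S).image (touching W)) fun M hM => Finset.mem_image_of_mem _ hM]
  refine Finset.sum_nonneg fun τ hτ => ?_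
  obtain ⟨N, hN, rfl⟩ := Finset.mem_image.1 hτ
  have hN' := mem_perfectMatchings.1 hN
  -- Every node of W in S is already covered by the edges of N touching W. A perfect matching on S
  -- containing these edges can have no further edge touching W, so the fibres are exactly the
  -- containment events controlled by `hc`.
  have hfib : (perfectMatchings S).filter (fun M => touching W M = touching W N) =
      (perfectMatchings S).filter (touching W N ⊆ ·) := by
    refine Finset.filter_congr fun M hM => ⟨fun h => h ▸ touching_subset W M, fun h => ?_⟩
    have hM' := mem_perfectMatchings.1 hM
    refine Finset.Subset.antisymm (fun e he => ?_) fun e he =>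
      mem_touching.2 ⟨h he, (mem_touching.1 he).2⟩
    obtain ⟨heM, v, hvW, hve⟩ := mem_touching.1 he
    obtain ⟨f, hf, hvf⟩ := (hN'.mem_iff v).1 ((hM'.mem_iff v).2 ⟨e, heM, hve⟩)
    have hf' : f ∈ touching W N := mem_touching.2 ⟨hf, v, hvW, hvf⟩
    rwa [hM'.isMatching.eq_of_mem heM (h hf') hve hvf]
  have hval : ∀ M ∈ (perfectMatchings S).filter (fun M => touching W M = touching W N),
      c M * a (M ∪ E₀) = c M * a (N ∪ E₀) := fun M hM => by
    obtain ⟨hM1, hM2⟩ := Finset.mem_filter.1 hM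
    obtain ⟨h1, h2⟩ := hmatch M hM1
    obtain ⟨h3, h4⟩ := hmatch N hN
    rw [apply_eq_of_touching_eq ha h1 h3 (h2.trans h4.symm) (by omega)
      (by rw [touching_union, touching_union, hM2])]
  rw [Finset.sum_congr rfl hval, ← Finset.sum_mul, hfib]
  exact mul_nonneg (hc _ (hN'.isMatching.mono (touching_subset _ _))
    (fun e he v hv => (hN'.mem_iff v).2 ⟨e, touching_subset _ _ he, hv⟩)
    ((hN'.isMatching.card_touching_le W).trans hWk)) (hpos N hN)

end Invariance

end SymExt

/-! ### Symmetries of an extension and averaged sections. -/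

namespace SymExt

open Equiv

theorem affineMap_sum_smul {ι V₁ V₂ : Type*} [AddCommGroup V₁] [Module ℝ V₁] [AddCommGroup V₂]
    [Module ℝ V₂] (f : V₁ →ᵃ[ℝ] V₂) (s : Finset ι) (w : ι → ℝ) (y : ι → V₁)
    (hw : ∑ i ∈ s, w i = 1) : f (∑ i ∈ s, w i • y i) = ∑ i ∈ s, w i • f (y i) := by
  have h : ∀ v, f v = f.linear v + f 0 := fun v => by
    have := f.map_vadd 0 v
    simpa using this
  have h' : ∀ i ∈ s, w i • f (y i) = f.linear (w i • y i) + w i • f 0 := fun i _ => by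
    rw [h (y i), smul_add, map_smul]
  rw [h, map_sum, Finset.sum_congr rfl h', Finset.sum_add_distrib, ← Finset.sum_smul, hw, one_smul]

section Isometries

variable {d : ℕ}

theorem coe_affineSpan_image (κ : RSpace d ≃ᵃⁱ[ℝ] RSpace d) (F : Set (RSpace d)) :
    affineSpan ℝ (κ '' F) = (affineSpan ℝ F).map κ.toAffineEquiv.toAffineMap :=
  (AffineSubspace.map_span (κ.toAffineEquiv.toAffineMap) F).symm

theorem finrank_direction_image (κ : RSpace d ≃ᵃⁱ[ℝ] RSpace d) (F : Set (RSpace d)) :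
    Module.finrank ℝ (affineSpan ℝ (κ '' F)).direction =
      Module.finrank ℝ (affineSpan ℝ F).direction := by
  rw [coe_affineSpan_image, AffineSubspace.map_direction]
  exact LinearEquiv.finrank_map_eq κ.toAffineEquiv.linear _

theorem infDist_image (κ : RSpace d ≃ᵃⁱ[ℝ] RSpace d) (F : Set (RSpace d)) (y : RSpace d) :
    Metric.infDist (κ y) (affineSpan ℝ (κ '' F)) = Metric.infDist y (affineSpan ℝ F) := by
  rw [coe_affineSpan_image, AffineSubspace.coe_map]
  exact Metric.infDist_image κ.isometry

theorem IsFacet.image {Q F : Set (RSpace d)} (hF : IsFacet Q F) (κ : RSpace d ≃ᵃⁱ[ℝ] RSpace d)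
    (hκ : κ '' Q = Q) : IsFacet Q (κ '' F) := by
  refine ⟨hF.1.image κ, fun _ => ?_, ?_⟩
  · obtain ⟨l, hl⟩ := hF.2.1 hF.1
    refine ⟨l.comp (κ.linearIsometryEquiv.symm : RSpace d →L[ℝ] RSpace d), ?_⟩
    have h : ∀ u v, l (κ.linearIsometryEquiv.symm (κ u)) ≤ l (κ.linearIsometryEquiv.symm (κ v)) ↔
        l u ≤ l v := fun u v => by
      have h1 : ∀ u, l (κ.linearIsometryEquiv.symm (κ u)) =
          l u + l (κ.linearIsometryEquiv.symm (κ 0)) := fun u => by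
        have h2 := κ.map_vadd 0 u
        simp only [vadd_eq_add, add_zero] at h2
        rw [h2, map_add, map_add, LinearIsometryEquiv.symm_apply_apply]
      rw [h1 u, h1 v, add_le_add_iff_right]
    ext x
    obtain ⟨x, rfl⟩ := κ.surjective x
    rw [κ.injective.mem_set_image, hl]
    constructor
    · rintro ⟨hx, hmax⟩
      refine ⟨hκ ▸ Set.mem_image_of_mem κ hx, fun y hy => ?_⟩
      rw [← hκ] at hy
      obtain ⟨y, hy, rfl⟩ := hy
      exact (h y x).2 (hmax y hy)
    · rintro ⟨hx, hmax⟩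
      rw [← hκ, κ.injective.mem_set_image] at hx
      exact ⟨hx, fun y hy => (h y x).1 (hmax _ (hκ ▸ Set.mem_image_of_mem κ hy))⟩
  · rw [finrank_direction_image, hF.2.2]

/-- The permutation of the facets induced by an isometric symmetry of the polyhedron. -/
noncomputable def facetPerm {Q : Set (RSpace d)} (hQ : IsPolyhedron Q)
    (κ : RSpace d ≃ᵃⁱ[ℝ] RSpace d) (hκ : κ '' Q = Q) : Perm {F | IsFacet Q F} :=
  haveI := hQ.finite_facets.to_subtype
  Equiv.ofBijective (fun F => ⟨κ '' F, F.2.image κ hκ⟩) (Finite.injective_iff_bijective.1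
    fun _ _ h => Subtype.ext (Set.image_injective.2 κ.injective (Subtype.ext_iff.1 h)))

end Isometries

section Section

variable {n d : ℕ} {P : Set (KEdge n → ℝ)} {Q : Set (RSpace d)} {p : RSpace d →ᵃ[ℝ] (KEdge n → ℝ)}

/-- The isometry `κ` of the extension `Q`, `p` induces the node permutation `π` and the facet
permutation `θ`. -/
structure Realizes (Q : Set (RSpace d)) (p : RSpace d →ᵃ[ℝ] (KEdge n → ℝ)) (π : Perm (Fin n))
    (θ : Perm {F | IsFacet Q F}) (κ : RSpace d ≃ᵃⁱ[ℝ] RSpace d) : Prop where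
  image_eq : κ '' Q = Q
  map_eq : ∀ y ∈ Q, p (κ y) = nodeAction n π (p y)
  facet_eq : ∀ F, (θ F : Set (RSpace d)) = κ '' F

theorem Realizes.mem {π : Perm (Fin n)} {θ : Perm {F | IsFacet Q F}}
    {κ : RSpace d ≃ᵃⁱ[ℝ] RSpace d} (h : Realizes Q p π θ κ) {y : RSpace d} (hy : y ∈ Q) :
    κ y ∈ Q := by
  have := Set.mem_image_of_mem κ hy
  rwa [h.image_eq] at this

theorem Realizes.symm_mem {π : Perm (Fin n)} {θ : Perm {F | IsFacet Q F}}
    {κ : RSpace d ≃ᵃⁱ[ℝ] RSpace d} (h : Realizes Q p π θ κ) {y : RSpace d} (hy : y ∈ Q) :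
    κ.symm y ∈ Q := by
  rw [← h.image_eq] at hy
  obtain ⟨y, hy, rfl⟩ := hy
  rwa [AffineIsometryEquiv.symm_apply_apply]

/-- The pairs of node and facet permutations that are induced by symmetries of the extension. -/
def symmetryGroup (Q : Set (RSpace d)) (p : RSpace d →ᵃ[ℝ] (KEdge n → ℝ)) :
    Subgroup (Perm (Fin n) × Perm {F | IsFacet Q F}) where
  carrier := {t | ∃ κ, Realizes Q p t.1 t.2 κ}
  one_mem' := ⟨AffineIsometryEquiv.refl ℝ _, by simp, by simp, by simp⟩
  mul_mem' := by
    rintro s t ⟨κ, hκ⟩ ⟨μ, hμ⟩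
    refine ⟨μ.trans κ, ?_, fun y hy => ?_, fun F => ?_⟩
    · rw [AffineIsometryEquiv.coe_trans, Set.image_comp, hμ.image_eq, hκ.image_eq]
    · rw [AffineIsometryEquiv.coe_trans, Function.comp_apply, hκ.map_eq _ (hμ.mem hy),
        hμ.map_eq y hy, Prod.fst_mul, map_mul]
      rfl
    · rw [AffineIsometryEquiv.coe_trans, Set.image_comp, ← hμ.facet_eq, ← hκ.facet_eq]
      rfl
  inv_mem' := by
    rintro t ⟨κ, hκ⟩
    refine ⟨κ.symm, ?_, fun y hy => ?_, fun F => ?_⟩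
    · conv_lhs => rw [← hκ.image_eq]
      rw [← Set.image_comp]
      simp
    · have h := hκ.map_eq _ (hκ.symm_mem hy)
      rw [AffineIsometryEquiv.apply_symm_apply] at h
      rw [h, Prod.fst_inv, map_inv]
      exact ((nodeAction n t.1).symm_apply_apply _).symm
    · have h := hκ.facet_eq (t.2⁻¹ F)
      rw [← Perm.mul_apply, mul_inv_cancel, Perm.one_apply] at h
      rw [h, ← Set.image_comp, Prod.snd_inv]
      simp

theorem exists_mem_symmetryGroup (h : IsSymmetricExtension (nodeGroup n) P Q p)
    (π : Perm (Fin n)) : ∃ θ, (π, θ) ∈ symmetryGroup Q p := by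
  obtain ⟨κ, hκ, hp⟩ := h.symmetric (nodeAction n π) ⟨π, rfl⟩
  exact ⟨facetPerm h.isPolyhedron κ hκ, κ, hκ, hp, fun F => rfl⟩

/-- A symmetric extension has a section such that the slack functions evaluated along it are
permuted by the nodes; the stabilizer of such a function has index at most the size. -/
theorem IsSymmetricExtension.exists_section (h : IsSymmetricExtension (nodeGroup n) P Q p)
    (hP : P.Nonempty) :
    ∃ (g : {F | IsFacet Q F} → RSpace d →ᵃ[ℝ] ℝ) (s : (KEdge n → ℝ) → RSpace d)
      (a : {F | IsFacet Q F} → (KEdge n → ℝ) → ℝ),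
      (∀ y ∈ affineSpan ℝ Q, (∀ F, 0 ≤ g F y) → y ∈ Q) ∧
      (∀ x ∈ P, s x ∈ Q ∧ p (s x) = x) ∧ (∀ F, ∀ x ∈ P, g F (s x) = a F x ∧ 0 ≤ a F x) ∧
      ∀ F, ∃ U : Subgroup (Perm (Fin n)), U.index ≤ size Q ∧
        ∀ π ∈ U, ∀ x, a F (nodeAction n π x) = a F x := by
  classical
  have hfin := h.isPolyhedron.finite_facets
  have := hfin.to_subtype
  have := Fintype.ofFinite (symmetryGroup Q p)
  have hQne : Q.Nonempty := by
    rw [← h.image_eq] at hP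
    exact hP.of_image
  obtain ⟨g, hg, hsep⟩ := h.isPolyhedron.exists_slacks hQne
  have hsec : ∀ x : KEdge n → ℝ, ∃ y : RSpace d, x ∈ P → y ∈ Q ∧ p y = x := fun x => by
    by_cases hx : x ∈ P
    · rw [← h.image_eq] at hx
      obtain ⟨y, hy, hyx⟩ := hx
      exact ⟨y, fun _ => ⟨hy, hyx⟩⟩
    · exact ⟨0, fun h => absurd h hx⟩
  choose y₀ hy₀ using hsec
  have hκ : ∀ t : symmetryGroup Q p, ∃ κ, Realizes Q p t.1.1 t.1.2 κ := fun t => t.2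
  choose κ hκ using hκ
  have hPact : ∀ t : symmetryGroup Q p, ∀ x ∈ P, nodeAction n t.1.1 x ∈ P := fun t x hx => by
    rw [← (hy₀ x hx).2, ← (hκ t).map_eq _ (hy₀ x hx).1, ← h.image_eq]
    exact Set.mem_image_of_mem p ((hκ t).mem (hy₀ x hx).1)
  set N : ℝ := (Fintype.card (symmetryGroup Q p) : ℝ) with hN
  have hNpos : 0 < N := by
    rw [hN]
    exact_mod_cast Fintype.card_pos
  have hw : ∑ _t : symmetryGroup Q p, N⁻¹ = 1 := by
    rw [Finset.sum_const, Finset.card_univ, nsmul_eq_mul, ← hN, mul_inv_cancel₀ hNpos.ne']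
  have hmem : ∀ x ∈ P, ∀ t : symmetryGroup Q p, (κ t).symm (y₀ (nodeAction n t.1.1 x)) ∈ Q :=
    fun x hx t => (hκ t).symm_mem (hy₀ _ (hPact t x hx)).1
  -- Slacks are distances to the hulls of facets, so isometries permute them together with the
  -- facets.
  have hslack : ∀ x ∈ P, ∀ t : symmetryGroup Q p, ∀ F,
      g F ((κ t).symm (y₀ (nodeAction n t.1.1 x))) = g (t.1.2 F) (y₀ (nodeAction n t.1.1 x)) := by
    intro x hx t F
    rw [hg F _ (hmem x hx t), hg _ _ (hy₀ _ (hPact t x hx)).1, (hκ t).facet_eq F, ← infDist_image (κ t),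
      AffineIsometryEquiv.apply_symm_apply]
  -- The chosen isometries need not form a group, so equivariance of the section is not claimed. Its
  -- slacks involve only the node and facet permutations, which do form a finite group, and this
  -- suffices for their invariance.
  refine ⟨g, fun x => ∑ t : symmetryGroup Q p, N⁻¹ • (κ t).symm (y₀ (nodeAction n t.1.1 x)),
    fun F x => ∑ t : symmetryGroup Q p, N⁻¹ • g (t.1.2 F) (y₀ (nodeAction n t.1.1 x)),
    hsep, fun x hx => ⟨?_, ?_⟩, fun F x hx => ⟨?_, ?_⟩, fun F => ?_⟩
  · exact h.isPolyhedron.convex.sum_mem (fun _ _ => (inv_pos.2 hNpos).le) hw fun t _ => hmem x hx t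
  · rw [affineMap_sum_smul p _ _ _ hw]
    have h1 : ∀ t : symmetryGroup Q p, p ((κ t).symm (y₀ (nodeAction n t.1.1 x))) = x := fun t => by
      refine (nodeAction n t.1.1).injective ?_
      rw [← (hκ t).map_eq _ (hmem x hx t), AffineIsometryEquiv.apply_symm_apply]
      exact (hy₀ _ (hPact t x hx)).2
    simp only [h1]
    rw [← Finset.sum_smul, hw, one_smul]
  · rw [affineMap_sum_smul (g F) _ _ _ hw]
    exact Finset.sum_congr rfl fun t _ => by rw [hslack x hx t F]
  · refine Finset.sum_nonneg fun t _ => smul_nonneg (inv_pos.2 hNpos).le ?_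
    rw [hg _ _ (hy₀ _ (hPact t x hx)).1]
    exact Metric.infDist_nonneg
  · let φ : symmetryGroup Q p →* Perm {F | IsFacet Q F} :=
      (MonoidHom.snd _ _).comp (symmetryGroup Q p).subtype
    let ψ : symmetryGroup Q p →* Perm (Fin n) :=
      (MonoidHom.fst _ _).comp (symmetryGroup Q p).subtype
    let _ : MulAction (symmetryGroup Q p) {F | IsFacet Q F} := MulAction.compHom _ φ
    have hψ : Function.Surjective ψ := fun π => by
      obtain ⟨θ, hθ⟩ := exists_mem_symmetryGroup h π
      exact ⟨⟨(π, θ), hθ⟩, rfl⟩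
    -- The index of the stabilizer is the size of the orbit of F, and passing to the image under the
    -- surjection `ψ` can only decrease it.
    refine ⟨(MulAction.stabilizer (symmetryGroup Q p) F).map ψ, ?_, ?_⟩
    · refine (Nat.le_of_dvd (Nat.pos_of_ne_zero Subgroup.index_ne_zero_of_finite)
        (Subgroup.index_map_dvd _ hψ)).trans ?_
      rw [MulAction.index_stabilizer]
      refine (Set.ncard_le_ncard (Set.subset_univ _)).trans ?_
      rw [Set.ncard_univ]
      rfl
    · rintro _ ⟨t, ht, rfl⟩ x
      have htF : t.1.2 F = F := ht
      refine Fintype.sum_equiv (Equiv.mulRight t) _ _ fun u => ?_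
      have h1 : ((u * t : symmetryGroup Q p) : Perm (Fin n) × Perm {F | IsFacet Q F}).2 F =
          u.1.2 F := by
        conv_rhs => rw [← htF]
        rfl
      have h2 : nodeAction n ((u * t : symmetryGroup Q p) :
          Perm (Fin n) × Perm {F | IsFacet Q F}).1 x = nodeAction n u.1.1 (nodeAction n t.1.1 x) := by
        rw [Subgroup.coe_mul, Prod.fst_mul, map_mul]
        rfl
      rw [Equiv.coe_mulRight, h1, h2]
      rfl

end Section

end SymExt

/-! ### The violated cut inequality and the lower bounds. -/

namespace SymExt

open Equiv

theorem sum_smul_mem_affineSpan {ι V : Type*} [AddCommGroup V] [Module ℝ V] {Q : Set V}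
    {s : Finset ι} {w : ι → ℝ} {y : ι → V} (hw : ∑ i ∈ s, w i = 1) (hy : ∀ i ∈ s, y i ∈ Q) :
    ∑ i ∈ s, w i • y i ∈ affineSpan ℝ Q := by
  obtain ⟨j, hj⟩ : s.Nonempty := by
    by_contra h
    rw [Finset.not_nonempty_iff_eq_empty.1 h] at hw
    simp at hw
  have hj' := subset_affineSpan ℝ Q (hy j hj)
  have h : ∑ i ∈ s, w i • y i = (∑ i ∈ s, w i • (y i -ᵥ y j)) +ᵥ y j := by
    simp only [vsub_eq_sub, smul_sub, vadd_eq_add]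
    rw [Finset.sum_sub_distrib, ← Finset.sum_smul, hw, one_smul, sub_add_cancel]
  rw [h]
  exact AffineSubspace.vadd_mem_of_mem_direction (Submodule.sum_mem _ fun i hi =>
    Submodule.smul_mem _ _ (AffineSubspace.vsub_mem_direction
      (subset_affineSpan ℝ Q (hy i hi)) hj')) hj'

section Bounds

variable {n : ℕ}

theorem charVec_apply (M : Finset (KEdge n)) (e : KEdge n) :
    charVec M e = if e ∈ M then 1 else 0 := by
  classical
  rw [charVec, Set.indicator_apply]
  simp

theorem nodeAction_charVec (π : Perm (Fin n)) (M : Finset (KEdge n)) :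
    nodeAction n π (charVec M) = charVec (mapEdges π M) := by
  ext e
  have h1 : nodeAction n π (charVec M) e = charVec M (edgePerm π⁻¹ e) := rfl
  have h2 : e = edgePerm π (edgePerm π⁻¹ e) := by
    rw [← edgePerm_mul, mul_inv_cancel, edgePerm_one]
  rw [h1]
  conv_rhs => rw [h2]
  simp only [charVec_apply, mem_mapEdges]

theorem charVec_mem {ℓ : ℕ} {M : Finset (KEdge n)} (hM : IsMatching M) (hcard : M.card = ℓ) :
    charVec M ∈ matchingPolytope n ℓ :=
  subset_convexHull ℝ _ ⟨M, hM, hcard, rfl⟩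

theorem le_sum_of_mem_matchingPolytope {ℓ : ℕ} (B : Finset (KEdge n)) {r : ℝ}
    (h : ∀ M : Finset (KEdge n), IsMatching M → M.card = ℓ → r ≤ ((M ∩ B).card : ℝ))
    {x : KEdge n → ℝ} (hx : x ∈ matchingPolytope n ℓ) : r ≤ ∑ e ∈ B, x e := by
  have hconv : Convex ℝ {x : KEdge n → ℝ | r ≤ ∑ e ∈ B, x e} := by
    refine convex_halfSpace_ge (f := fun x : KEdge n → ℝ => ∑ e ∈ B, x e) ⟨fun x y => ?_, fun c x => ?_⟩ r
    · simp [Finset.sum_add_distrib]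
    · simp [Finset.mul_sum]
  refine convexHull_min ?_ hconv hx
  rintro _ ⟨M, hM, hcard, rfl⟩
  refine (h M hM hcard).trans_eq ?_
  simp only [charVec_apply]
  rw [Finset.inter_comm, ← Finset.filter_mem_eq_inter, Finset.card_filter]
  push_cast
  rfl

theorem IsMatching.two_mul_card_le {M : Finset (KEdge n)} (hM : IsMatching M) {T : Finset (Fin n)}
    (h : ∀ e ∈ M, endsIn T e = 2) : 2 * M.card ≤ T.card := by
  have h' : ∀ e ∈ M, (T.filter fun v => v ∈ (e : Sym2 (Fin n))).card = 2 := h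
  have h1 : (M.biUnion fun e => T.filter fun v => v ∈ (e : Sym2 (Fin n))).card = 2 * M.card := by
    rw [Finset.card_biUnion]
    · rw [Finset.sum_congr rfl h', Finset.sum_const, smul_eq_mul, mul_comm]
    · intro e he f hf hne
      refine Finset.disjoint_left.2 fun v hv hv' => ?_
      exact hne (hM.eq_of_mem he hf (Finset.mem_filter.1 hv).2 (Finset.mem_filter.1 hv').2)
  rw [← h1]
  exact Finset.card_le_card (Finset.biUnion_subset.2 fun e _ => Finset.filter_subset _ _)

open Classical in
/-- The edges within `S` with no or both nodes in `A`, together with those in `E₀`. -/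
noncomputable def uncutEdges (A S : Finset (Fin n)) (E₀ : Finset (KEdge n)) : Finset (KEdge n) :=
  Finset.univ.filter fun e =>
    ((∀ v ∈ (e : Sym2 (Fin n)), v ∈ S) ∧ endsIn A e ≠ 1) ∨ e ∈ E₀

theorem mem_uncutEdges {A S : Finset (Fin n)} {E₀ : Finset (KEdge n)} {e : KEdge n} :
    e ∈ uncutEdges A S E₀ ↔ ((∀ v ∈ (e : Sym2 (Fin n)), v ∈ S) ∧ endsIn A e ≠ 1) ∨ e ∈ E₀ := by
  simp [uncutEdges]

/-- Both A and S \ A have the odd size 2k+1, so each contains at most k disjoint edges. -/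
theorem IsMatching.card_le_of_subset_uncutEdges {A S : Finset (Fin n)} {k : ℕ} (hAS : A ⊆ S)
    (hA : A.card = 2 * k + 1) (hS : S.card = 4 * k + 2) {E₀ M : Finset (KEdge n)}
    (hM : IsMatching M) (h : M ⊆ uncutEdges A S E₀) : M.card ≤ 2 * k + E₀.card := by
  set M₂ := (M \ E₀).filter fun e => endsIn A e = 2 with hM₂
  set M₀ := (M \ E₀).filter fun e => ¬ endsIn A e = 2 with hM₀
  have h2 := (hM.mono ((Finset.filter_subset _ _).trans Finset.sdiff_subset) :
    IsMatching M₂).two_mul_card_le (T := A) fun e he => (Finset.mem_filter.1 he).2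
  have h0 := (hM.mono ((Finset.filter_subset _ _).trans Finset.sdiff_subset) :
    IsMatching M₀).two_mul_card_le (T := S \ A) fun e he => by
      obtain ⟨he1, he2⟩ := Finset.mem_filter.1 he
      obtain ⟨heM, heE⟩ := Finset.mem_sdiff.1 he1
      obtain ⟨heS, he3⟩ := (mem_uncutEdges.1 (h heM)).resolve_right heE
      obtain ⟨u, v, huv, rfl⟩ := exists_eq_mkEdge e
      simp only [mem_mkEdge, forall_eq_or_imp, forall_eq] at heS
      rw [endsIn_mkEdge] at he2 he3 ⊢
      simp only [Finset.mem_sdiff, heS.1, heS.2, true_and]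
      by_cases hu : u ∈ A <;> by_cases hv : v ∈ A <;> simp_all
  rw [hA] at h2
  rw [Finset.card_sdiff_of_subset hAS, hA, hS] at h0
  have h3 : M₂.card + M₀.card = (M \ E₀).card := Finset.card_filter_add_card_filter_not _
  have h4 := Finset.card_le_card_sdiff_add_card (s := M) (t := E₀)
  omega

theorem exists_node_sets {n k ℓ : ℕ} (hℓ : 2 * ℓ ≤ n) (hk₁ : 2 * k + 1 ≤ ℓ) :
    ∃ (A S : Finset (Fin n)) (E₀ : Finset (KEdge n)), A ⊆ S ∧ A.card = 2 * k + 1 ∧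
      S.card = 4 * k + 2 ∧ IsMatching E₀ ∧ E₀.card = ℓ - (2 * k + 1) ∧
      ∀ e ∈ E₀, ∀ v ∈ (e : Sym2 (Fin n)), v ∉ S := by
  obtain ⟨S, -, hS⟩ := Finset.exists_subset_card_eq (s := (Finset.univ : Finset (Fin n)))
    (n := 4 * k + 2) (by rw [Finset.card_univ, Fintype.card_fin]; omega)
  obtain ⟨A, hAS, hA⟩ := Finset.exists_subset_card_eq (s := S) (n := 2 * k + 1) (by omega)
  obtain ⟨R, hRS, hR⟩ := Finset.exists_subset_card_eq (s := Sᶜ) (n := 2 * (ℓ - (2 * k + 1)))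
    (by rw [Finset.card_compl, Fintype.card_fin]; omega)
  obtain ⟨E₀, hE₀, -⟩ := exists_isPerfectOn ∅ 0 0 (ℓ - (2 * k + 1)) R (by simp) (by simp [hR])
  refine ⟨A, S, E₀, hAS, hA, hS, hE₀.isMatching, ?_, fun e he v hv => ?_⟩
  · have := hE₀.card_eq
    omega
  · exact Finset.mem_compl.1 (hRS ((hE₀.mem_iff v).2 ⟨e, he, hv⟩))

theorem exists_two_matchings {n ℓ : ℕ} (hn : 3 ≤ n) (hℓ₁ : 1 ≤ ℓ) (hℓ : 2 * ℓ ≤ n) :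
    ∃ M N : Finset (KEdge n), IsMatching M ∧ IsMatching N ∧ M.card = ℓ ∧ N.card = ℓ ∧ M ≠ N := by
  obtain ⟨M, hM, hcard⟩ := exists_isMatching_card n ℓ hℓ
  obtain ⟨e, he⟩ := Finset.card_pos.1 (show 0 < M.card by omega)
  obtain ⟨u, v, huv, rfl⟩ := exists_eq_mkEdge e
  obtain ⟨w, hw⟩ : ∃ w, w ∉ ({u, v} : Finset (Fin n)) := by
    by_contra! h
    have h1 := Finset.card_le_card (fun w _ => h w : (Finset.univ : Finset (Fin n)) ⊆ {u, v})
    rw [Finset.card_univ, Fintype.card_fin] at h1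
    have h2 := Finset.card_le_two (a := u) (b := v)
    omega
  simp only [Finset.mem_insert, Finset.mem_singleton, not_or] at hw
  refine ⟨M, mapEdges (swap v w) M, hM, hM.mapEdges _, hcard, by rw [card_mapEdges, hcard],
    fun h => ?_⟩
  have h1 : edgePerm (swap v w) (mkEdge u v huv) ∈ M := by
    rw [h]
    exact mem_mapEdges.2 he
  have h2 : edgePerm (swap v w) (mkEdge u v huv) = mkEdge u w (Ne.symm hw.1) := by
    simp only [edgePerm_mkEdge, swap_apply_left, swap_apply_of_ne_of_ne huv (Ne.symm hw.1)]
  rw [h2] at h1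
  have h3 := hM.eq_of_mem he h1 (v := u) ((mem_mkEdge _).2 (Or.inl rfl)) ((mem_mkEdge _).2 (Or.inl rfl))
  have h4 : w ∈ (mkEdge u v huv : Sym2 (Fin n)) := by
    rw [h3]
    exact (mem_mkEdge _).2 (Or.inr rfl)
  rcases (mem_mkEdge huv).1 h4 with h5 | h5
  exacts [hw.1 h5, hw.2 h5]

theorem mem_Icc_of_mem_matchingPolytope {ℓ : ℕ} {x : KEdge n → ℝ}
    (hx : x ∈ matchingPolytope n ℓ) (e : KEdge n) : x e ∈ Set.Icc (0 : ℝ) 1 := by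
  have hconv : Convex ℝ {x : KEdge n → ℝ | x e ∈ Set.Icc (0 : ℝ) 1} :=
    (convex_Icc (0 : ℝ) 1).linear_preimage (LinearMap.proj e : (KEdge n → ℝ) →ₗ[ℝ] ℝ)
  refine convexHull_min ?_ hconv hx
  rintro _ ⟨M, -, -, rfl⟩
  simp only [Set.mem_ofPred_eq, charVec_apply]
  split_ifs <;> simp

variable {d : ℕ} {Q : Set (RSpace d)} {p : RSpace d →ᵃ[ℝ] (KEdge n → ℝ)} {ℓ : ℕ}

/-- A polyhedron without facets fills its affine hull. A line through preimages of two distinct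
vertices would then map to a line inside a bounded polytope. -/
theorem one_le_size (hn : 3 ≤ n) (hℓ₁ : 1 ≤ ℓ) (hℓ : 2 * ℓ ≤ n)
    (h : IsExtension (matchingPolytope n ℓ) Q p) : 1 ≤ size Q := by
  by_contra! hlt
  have hfin := h.isPolyhedron.finite_facets
  have hempty : {F | IsFacet Q F} = ∅ := (Set.ncard_eq_zero hfin).1 (by unfold size at hlt; omega)
  obtain ⟨M, N, hM, hN, hMc, hNc, hMN⟩ := exists_two_matchings hn hℓ₁ hℓ
  have hxM := charVec_mem hM hMc
  have hxN := charVec_mem hN hNc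
  rw [← h.image_eq] at hxM hxN
  obtain ⟨y, hy, hyM⟩ := hxM
  obtain ⟨z, hz, hzN⟩ := hxN
  obtain ⟨g, -, hsep⟩ := h.isPolyhedron.exists_slacks ⟨y, hy⟩
  obtain ⟨e, he⟩ : ∃ e, charVec M e ≠ charVec N e := by
    by_contra! heq
    refine hMN (Finset.ext fun e => ?_)
    have := heq e
    rw [charVec_apply, charVec_apply] at this
    by_cases h1 : e ∈ M <;> by_cases h2 : e ∈ N <;> simp_all
  have hline : ∀ t : ℝ, (AffineMap.lineMap y z t : RSpace d) ∈ Q := fun t =>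
    hsep _ (AffineMap.lineMap_mem t (subset_affineSpan ℝ _ hy) (subset_affineSpan ℝ _ hz))
      fun F => ((Set.eq_empty_iff_forall_notMem.1 hempty) F F.2).elim
  have hval : ∀ t : ℝ, charVec M e + t * (charVec N e - charVec M e) ∈ Set.Icc (0 : ℝ) 1 := by
    intro t
    have h1 : p (AffineMap.lineMap y z t) ∈ matchingPolytope n ℓ := by
      rw [← h.image_eq]
      exact Set.mem_image_of_mem p (hline t)
    have h2 := mem_Icc_of_mem_matchingPolytope h1 e
    rw [AffineMap.apply_lineMap, hyM, hzN, AffineMap.lineMap_apply] at h2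
    simpa [add_comm] using h2
  have h1 := hval 2
  have h2 := hval (-2)
  rw [charVec_apply, charVec_apply] at h1 h2 he
  by_cases h3 : e ∈ M <;> by_cases h4 : e ∈ N <;> simp [h3, h4] at he h1 h2

theorem choose_le_size {n₀ : ℕ} (hn₀ : ∀ (α : Type) [Fintype α] [DecidableEq α],
      n₀ ≤ Fintype.card α → ∀ k : ℕ, 4 * k < Fintype.card α → ∀ U : Subgroup (Perm α),
      U.index < (Fintype.card α).choose k → ∃ W : Finset α, W.card ≤ k ∧
        ∀ a b c d : α, a ∉ W → b ∉ W → c ∉ W → d ∉ W → a ≠ b → c ≠ d →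
          swap a b * swap c d ∈ U)
    (hn : n₀ ≤ n) {k : ℕ} (hk : 1 ≤ k) (hkℓ : 2 * k + 1 ≤ ℓ) (hℓ : 2 * ℓ ≤ n)
    (h : IsSymmetricExtension (nodeGroup n) (matchingPolytope n ℓ) Q p) :
    n.choose k ≤ size Q := by
  classical
  by_contra! hlt
  obtain ⟨A, S, E₀, hAS, hA, hS, hE₀, hE₀c, hE₀S⟩ := exists_node_sets hℓ hkℓ
  obtain ⟨c, hc, hc1, hc0⟩ := exists_signed_weights hk hAS hA hS
  have hP : ∀ M ∈ perfectMatchings S, charVec (M ∪ E₀) ∈ matchingPolytope n ℓ := fun M hM => by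
    have hM' := mem_perfectMatchings.1 hM
    obtain ⟨h1, h2⟩ := hM'.union hE₀ hE₀S
    refine charVec_mem h1 ?_
    rw [Finset.card_union_of_disjoint h2]
    have := hM'.card_eq
    omega
  have hPne : (matchingPolytope n ℓ).Nonempty := by
    obtain ⟨M, hM, hcard⟩ := exists_isMatching_card n ℓ hℓ
    exact ⟨_, charVec_mem hM hcard⟩
  obtain ⟨g, s, a, hsep, hs, hga, hU⟩ := h.exists_section hPne
  set z : RSpace d := ∑ M ∈ perfectMatchings S, c M • s (charVec (M ∪ E₀)) with hz
  have hzspan : z ∈ affineSpan ℝ Q :=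
    sum_smul_mem_affineSpan hc1 fun M hM => (hs _ (hP M hM)).1
  -- Although some weights may be negative, every slack of z is nonnegative, because it is a
  -- function on matchings invariant under the even permutations fixing at most k nodes.
  have hzQ : z ∈ Q := hsep z hzspan fun F => by
    rw [hz, affineMap_sum_smul _ _ _ _ hc1]
    obtain ⟨U, hUi, hUa⟩ := hU F
    obtain ⟨W, hWk, hW⟩ := hn₀ (Fin n) (by simpa using hn) k (by simp; omega) U
      (by simpa using hUi.trans_lt hlt)
    have h1 := sum_weights_mul_nonneg (a := fun M => a F (charVec M)) hS hc hE₀ hE₀S hWk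
      (fun q r t u hq hr ht hu hqr htu M => by
        rw [← nodeAction_charVec]
        exact hUa _ (hW q r t u hq hr ht hu hqr htu) _)
      fun M hM => (hga F _ (hP M hM)).2
    refine h1.trans_eq (Finset.sum_congr rfl fun M hM => ?_)
    rw [(hga F _ (hP M hM)).1, smul_eq_mul]
  have hpz : p z ∈ matchingPolytope n ℓ := by
    rw [← h.image_eq]
    exact Set.mem_image_of_mem p hzQ
  -- As `E₀` has ℓ - (2k+1) edges, a matching of uncut edges has at most ℓ - 1; every matching of
  -- size ℓ therefore uses an edge of the complement.
  have hcut := le_sum_of_mem_matchingPolytope (uncutEdges A S E₀)ᶜ (r := 1) (fun M hM hcard => by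
    have h1 : ¬ M ⊆ uncutEdges A S E₀ := fun hsub => by
      have := hM.card_le_of_subset_uncutEdges hAS hA hS hsub
      omega
    obtain ⟨e, he, he'⟩ := Finset.not_subset.1 h1
    exact_mod_cast Finset.card_pos.2
      ⟨e, Finset.mem_inter.2 ⟨he, Finset.mem_compl.2 he'⟩⟩) hpz
  -- On M ∪ E₀ this sum counts exactly the edges of M leaving A, whose weighted total is zero.
  have hzero : ∑ e ∈ (uncutEdges A S E₀)ᶜ, p z e = 0 := by
    have h1 : p z = ∑ M ∈ perfectMatchings S, c M • charVec (M ∪ E₀) := by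
      rw [hz, affineMap_sum_smul _ _ _ _ hc1]
      exact Finset.sum_congr rfl fun M hM => by rw [(hs _ (hP M hM)).2]
    simp only [h1, Finset.sum_apply, Pi.smul_apply, smul_eq_mul]
    rw [Finset.sum_comm, ← hc0]
    refine Finset.sum_congr rfl fun M hM => ?_
    have hM' := mem_perfectMatchings.1 hM
    rw [← Finset.mul_sum]
    congr 1
    simp only [charVec_apply]
    rw [numEnds, Finset.sum_boole]
    congr 2
    ext e
    simp only [Finset.mem_filter, Finset.mem_compl, mem_uncutEdges, Finset.mem_union]
    constructor
    · rintro ⟨h2, h3⟩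
      push Not at h2
      have heM := h3.resolve_right h2.2
      exact ⟨heM, h2.1 fun v hv => (hM'.mem_iff v).2 ⟨e, heM, hv⟩⟩
    · rintro ⟨heM, he1⟩
      refine ⟨?_, Or.inl heM⟩
      rintro (⟨-, h2⟩ | h2)
      · exact h2 he1
      · exact Finset.disjoint_left.1 (hM'.union hE₀ hE₀S).2 heM h2
  linarith

end Bounds

end SymExt

theorem theorem3p3 :
    ∃ C : ℝ, 0 < C ∧
      ∀ n ℓ : ℕ, 3 ≤ n → 1 ≤ ℓ → 2 * ℓ ≤ n →
        ∀ (d : ℕ) (Q : Set (SymExt.RSpace d)) (p : SymExt.RSpace d →ᵃ[ℝ] (SymExt.KEdge n → ℝ)),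
          SymExt.IsSymmetricExtension (SymExt.nodeGroup n) (SymExt.matchingPolytope n ℓ) Q p →
            C * (n.choose ((ℓ - 1) / 2) : ℝ) ≤ (SymExt.size Q : ℝ) := by
  obtain ⟨n₀, hn₀⟩ := SymExt.exists_small_set_of_index_lt
  -- The constant absorbs all n below `n₀`, where the binomial coefficient is at most 2^n₀ and a
  -- single facet suffices.
  refine ⟨(2 ^ n₀)⁻¹, by positivity, fun n ℓ hn hℓ₁ hℓ d Q p h => ?_⟩
  have hone : (1 : ℝ) ≤ SymExt.size Q := by
    exact_mod_cast SymExt.one_le_size hn hℓ₁ hℓ h.toIsExtension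
  rw [inv_mul_le_iff₀ (by positivity)]
  by_cases hlarge : n₀ ≤ n ∧ 1 ≤ (ℓ - 1) / 2
  · have h1 : (n.choose ((ℓ - 1) / 2) : ℝ) ≤ SymExt.size Q := by
      exact_mod_cast SymExt.choose_le_size hn₀ hlarge.1 hlarge.2 (by omega) hℓ h
    have h2 : (1 : ℝ) ≤ 2 ^ n₀ := one_le_pow₀ (by norm_num)
    nlinarith
  · have h1 : n.choose ((ℓ - 1) / 2) ≤ 2 ^ n₀ := by
      by_cases hk : (ℓ - 1) / 2 = 0
      · rw [hk, Nat.choose_zero_right]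
        exact Nat.one_le_two_pow
      · exact (Nat.choose_le_two_pow _ _).trans
          (Nat.pow_le_pow_right (by norm_num) (by omega))
    have h2 : (n.choose ((ℓ - 1) / 2) : ℝ) ≤ 2 ^ n₀ := by exact_mod_cast h1
    nlinarith
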